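/- All graphs are finite and loopless; parallel edges are allowed. A cycle is a connected $2$-regular graph. A Kotzig graph is a cubic graph that admits a proper $3$-edge-coloring in which every cycle whose edges use at most two of the three colors is hamiltonian. A subdivision of a graph $H$ is obtained from $H$ by replacing at least one edge $vw$ of $H$ by a $vw$-path of length at least $2$. A Kotzig-frame of a cubic graph $G$ is a spanning subgraph $F$ of $G$ such that every component of $F$ has an even number of vertices and is either a cycle or a subdivision of a Kotzig graph; the components of $F$ that are not cycles are called K-components. A $k$-cycle double cover of $G$ is a set $S$ of cycles of $G$ such that every edge of $G$ is contained in precisely two cycles of $S$, and such that $S$ can be partitioned into $k$ (possibly empty) subsets each of which consists of pairwise edge-disjoint cycles. Let $G$ be a cubic graph with a Kotzig-frame $F$ which has at most two K-components. Then $G$ has a $6$-cycle double cover. -/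

import Mathlib

namespace Graph

variable {α β : Type*}

/-- The degree of `x` in `G`: the number of incident edges, loops being counted twice. -/
noncomputable def degree (G : Graph α β) (x : α) : ℕ :=
  (G.incidenceSet x).ncard + (G.loopSet x).ncard

/-- `G` is a finite graph. -/
def IsFinite (G : Graph α β) : Prop :=
  V(G).Finite ∧ E(G).Finite

/-- `G` is cubic (3-regular). -/
def IsCubic (G : Graph α β) : Prop :=
  ∀ x ∈ V(G), G.degree x = 3

/-- `G` is nonempty and any two of its vertices are joined by a walk. -/
def IsConnected (G : Graph α β) : Prop :=
  V(G).Nonempty ∧ ∀ x ∈ V(G), ∀ y ∈ V(G), Relation.ReflTransGen G.Adj x y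

/-- A cycle: a finite loopless connected 2-regular graph (two parallel edges form a cycle). -/
structure IsCycle (C : Graph α β) : Prop where
  isFinite : C.IsFinite
  loopless : C.Loopless
  connected : C.IsConnected
  regular : ∀ x ∈ V(C), C.degree x = 2

/-- `L` is a connected component of `F`. -/
def IsComponent (L F : Graph α β) : Prop :=
  L ≤c F ∧ L.IsConnected

/-- `P` is a path with end vertices `v` and `w`: its distinct vertices, in order, are
`p 0, …, p n`, and its distinct edges are `q 0, …, q (n - 1)`, where `q i` joins `p i` to
`p (i + 1)`. -/
def IsPathBetween (P : Graph α β) (v w : α) : Prop :=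
  ∃ (n : ℕ) (p : ℕ → α) (q : ℕ → β),
    Set.InjOn p (Set.Iic n) ∧ Set.InjOn q (Set.Iio n) ∧ p 0 = v ∧ p n = w ∧
    V(P) = p '' Set.Iic n ∧ E(P) = q '' Set.Iio n ∧
    ∀ i < n, P.IsLink (q i) (p i) (p (i + 1))

/-- `c` is a proper edge-coloring of `G` with three colors. -/
def IsProperEdgeColoring (G : Graph α β) (c : β → Fin 3) : Prop :=
  ∀ ⦃e f : β⦄ ⦃x : α⦄, G.Inc e x → G.Inc f x → e ≠ f → c e ≠ c f

/-- `c` is a Kotzig-coloring of `K`: a proper 3-edge-coloring such that each bicolored cycle,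
i.e. each cycle of `K` in which at least one of the three colors does not occur, is hamiltonian. -/
def IsKotzigColoring (K : Graph α β) (c : β → Fin 3) : Prop :=
  K.IsProperEdgeColoring c ∧
    ∀ C : Graph α β, C ≤ K → C.IsCycle → (∃ i, ∀ e ∈ E(C), c e ≠ i) → V(C) = V(K)

/-- A Kotzig graph: a (finite, loopless) cubic graph admitting a Kotzig-coloring. -/
structure IsKotzigGraph (K : Graph α β) : Prop where
  isFinite : K.IsFinite
  loopless : K.Loopless
  nonempty : V(K).Nonempty
  cubic : K.IsCubic
  exists_coloring : ∃ c, K.IsKotzigColoring c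

/-- `H'` is a subdivision of the loopless graph `H`: it is obtained from `H` by replacing every
edge `e = vw` by a `vw`-path `P e`, where at least one of these paths has length at least `2`
(a path of length `1` means that the edge is kept). The replacing paths are edge-disjoint and
have no common vertices other than vertices of `H`, and among the vertices of `H`
the path `P e` contains only the ends of `e`. -/
def IsSubdivision (H' H : Graph α β) : Prop :=
  ∃ P : β → Graph α β,
    (∀ ⦃e v w⦄, H.IsLink e v w → P e ≤ H' ∧ (P e).IsPathBetween v w) ∧
    (∀ e ∈ E(H), ∀ x ∈ V(P e), x ∈ V(H) → H.Inc e x) ∧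
    (∀ e ∈ E(H), ∀ f ∈ E(H), e ≠ f →
      Disjoint E(P e) E(P f) ∧ V(P e) ∩ V(P f) ⊆ V(H)) ∧
    V(H') = V(H) ∪ ⋃ e ∈ E(H), V(P e) ∧
    E(H') = ⋃ e ∈ E(H), E(P e) ∧
    ∃ e ∈ E(H), E(P e).Nontrivial

/-- `L` is a subdivision of a Kotzig graph. There is no loss in taking the Kotzig graph over the
same vertex and edge types: its vertices are vertices of `L`, and each of its edges may be
named by an edge of the path that replaces it. -/
def IsKotzigSubdivision (L : Graph α β) : Prop :=
  ∃ K : Graph α β, K.IsKotzigGraph ∧ L.IsSubdivision K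

/-- `F` is a Kotzig-frame of `G`: a spanning subgraph all of whose components have an even number
of vertices and are cycles or subdivisions of Kotzig graphs. -/
structure IsKotzigFrame (F G : Graph α β) : Prop where
  spanning : F ≤s G
  even : ∀ L : Graph α β, L.IsComponent F → Even V(L).ncard
  cycle_or_kotzig : ∀ L : Graph α β, L.IsComponent F → L.IsCycle ∨ L.IsKotzigSubdivision

/-- The K-components of `F`: the components that are not cycles. -/
def kComponents (F : Graph α β) : Set (Graph α β) :=
  {L : Graph α β | L.IsComponent F ∧ ¬ L.IsCycle}

/-- `S` is a cycle double cover of `G`: a set of cycles of `G` such that every edge of `G` is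
contained in precisely two of them. -/
def IsCycleDoubleCover (G : Graph α β) (S : Set (Graph α β)) : Prop :=
  (∀ C ∈ S, C ≤ G ∧ C.IsCycle) ∧ ∀ e ∈ E(G), {C ∈ S | e ∈ E(C)}.encard = 2

/-- `G` has a `k`-cycle double cover: a cycle double cover that can be split into `k` (possibly
empty) classes, each of which consists of pairwise edge-disjoint cycles. -/
def HasCycleDoubleCover (k : ℕ) (G : Graph α β) : Prop :=
  ∃ S : Set (Graph α β), G.IsCycleDoubleCover S ∧
    ∃ cls : Graph α β → Fin k, ∀ C ∈ S, ∀ D ∈ S, C ≠ D → cls C = cls D →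
      Disjoint E(C) E(D)

end Graph

/-! Let `D` be the edge set of the frame; the edges outside `D` form a matching. The six classes
come in three pairs, one pair for each type `t : Fin 3`. A matching edge receives one type and lies
in both classes of that pair. An edge of `D` receives one excluded type and lies in exactly one
class of each of the other two pairs. Choosing that class is, for each `t`, a T-join problem in the
edges of `D` not excluding `t`, where T consists of the ends of the matching edges of type `t`; it
is solvable once T is even on every component of these edges (`hasCycleDoubleCover_of_types`). The
components of the resulting even sets are the cycles of the cover
(`hasCycleDoubleCover_of_even_sets`).

On a cycle of the frame the excluded type is constant. On a K-component it is a permuted Kotzig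
coloring, carried over to the subdivision. By the Kotzig property the edges avoiding a given color
are connected, and a matching edge has a type different from the color at its end. So the parity
condition only asks that each type occurs an even number of times on each component of the frame.

Remove the edges of the K-components and call the components of what is left objects. All cycles in
an object exclude the same type `x`, and its matching edges have type `x + 1` or `x + 2`. Once the
types at the stubs, i.e. the ends of matching edges on K-components, are prescribed evenly on the
object, a T-join inside the object fixes all other types, and evenness on its cycles is automatic.

What remains is `exists_perm_evenValues`: give each stub a value that differs from its color and
from the type excluded by its object, with even parity on every object and every K-component. If `x`
is the color of some stub of the object, that pivot is free to take two values and repairs the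
parity of the object. With two K-components only one side needs repair, because the totals are even.
Switching two pivots of one object on opposite sides changes the side and preserves the object;
permuting the colors of a side produces enough such pairs. -/

open Finset in
/-- The parity of the number of elements of `A` that get the value `t` under `f`. -/
noncomputable def valueParity {S : Type*} (A : Finset S) (f : S → Fin 3) (t : Fin 3) : ZMod 2 :=
  ∑ u ∈ A, if f u = t then 1 else 0

/-! ### Values at the stubs: parities on objects and sides. -/

section TypeAssignment

open Finset

variable {S Ω : Type*}

theorem even_card_filter_iff (A : Finset S) (p : S → Prop) [DecidablePred p] :
    Even #{u ∈ A | p u} ↔ ∑ u ∈ A, (if p u then (1 : ZMod 2) else 0) = 0 := by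
  rw [← ZMod.natCast_eq_zero_iff_even, Finset.sum_boole]

theorem valueParity_eq_zero_iff (A : Finset S) (f : S → Fin 3) (t : Fin 3) :
    valueParity A f t = 0 ↔ Even #{u ∈ A | f u = t} :=
  (even_card_filter_iff A _).symm

theorem valueParity_sum (A : Finset S) (f : S → Fin 3) :
    valueParity A f 0 + valueParity A f 1 + valueParity A f 2 = (#A : ZMod 2) := by
  unfold valueParity
  rw [← sum_add_distrib, ← sum_add_distrib, card_eq_sum_ones, Nat.cast_sum]
  refine sum_congr rfl fun u _ ↦ ?_
  generalize f u = a
  revert a; decide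

theorem valueParity_eq_zero_of_forall_ne {A : Finset S} {f : S → Fin 3} {x : Fin 3}
    (h : ∀ u ∈ A, f u ≠ x) : valueParity A f x = 0 :=
  sum_eq_zero fun u hu ↦ if_neg (h u hu)

/-- If `f` avoids `x` on the even set `A` and takes one further value an even number of times, then
it takes every value an even number of times. -/
theorem valueParity_eq_zero {A : Finset S} {f : S → Fin 3} {x : Fin 3}
    (h : ∀ u ∈ A, f u ≠ x) (hA : (#A : ZMod 2) = 0) (h1 : valueParity A f (x + 1) = 0)
    (t : Fin 3) : valueParity A f t = 0 := by
  have h0 := valueParity_eq_zero_of_forall_ne h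
  have hs := valueParity_sum A f
  rw [hA] at hs
  fin_cases x <;> fin_cases t <;> simp_all

open Classical in
/-- A choice of values avoiding both the colour `c` and the value `x` excluded by the object, which
is even on each object. -/
theorem exists_even_values (St : Finset S) (c : S → Fin 3) (ob : S → Ω) (x : Ω → Fin 3)
    (hpiv : ∀ s ∈ St, ∃ p ∈ St, ob p = ob s ∧ c p = x (ob s))
    (hev : ∀ s ∈ St, Even #{u ∈ St | ob u = ob s}) :
    ∃ f : S → Fin 3, (∀ s ∈ St, f s ≠ c s ∧ f s ≠ x (ob s)) ∧
      ∀ s ∈ St, ∀ t, valueParity {u ∈ St | ob u = ob s} f t = 0 := by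
  -- `s0` serves only as a default pivot for objects without elements.
  obtain rfl | ⟨s0, -⟩ := St.eq_empty_or_nonempty
  · exact ⟨fun _ ↦ 0, by simp, by simp⟩
  have hpiv' : ∀ ω : Ω, ∃ p, (∃ s ∈ St, ob s = ω) → p ∈ St ∧ ob p = ω ∧ c p = x ω := by
    intro ω
    by_cases h : ∃ s ∈ St, ob s = ω
    · obtain ⟨s, hs, rfl⟩ := h
      obtain ⟨p, hp, h1, h2⟩ := hpiv s hs
      exact ⟨p, fun _ ↦ ⟨hp, h1, h2⟩⟩
    · exact ⟨s0, fun h' ↦ absurd h' h⟩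
  choose piv hp using hpiv'
  -- Since `0 + 1 + 2 = 0` in `Fin 3`, the third value besides two distinct `a`, `b` is `-(a + b)`.
  -- A pivot starts at `x + 1` and is moved to `x + 2` exactly when the parity of `x + 1` on its
  -- object is odd.
  set f0 : S → Fin 3 := fun s ↦ if c s = x (ob s) then x (ob s) + 1 else -(c s + x (ob s)) with hf0
  set f : S → Fin 3 := fun s ↦
    if s = piv (ob s) ∧ valueParity {u ∈ St | ob u = ob s} f0 (x (ob s) + 1) = 1
      then x (ob s) + 2 else f0 s with hf
  have hval : ∀ s ∈ St, f s ≠ c s ∧ f s ≠ x (ob s) := by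
    intro s hs
    simp only [hf, hf0]
    have := hp (ob s) ⟨s, hs, rfl⟩
    split_ifs with h1 h2
    · have h3 : c s = x (ob s) := (congrArg c h1.1).trans this.2.2
      rw [h3]; generalize x (ob s) = a; revert a; decide
    · rw [h2]; generalize x (ob s) = a; revert a; decide
    · revert h2; generalize x (ob s) = a; generalize c s = b; revert a b; decide
  refine ⟨f, hval, fun s hs ↦ ?_⟩
  refine valueParity_eq_zero (x := x (ob s)) ?_ ?_ ?_
  · intro u hu
    simp only [mem_filter] at hu
    rw [← hu.2]; exact (hval u hu.1).2
  · rw [ZMod.natCast_eq_zero_iff_even]; exact hev s hs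
  · obtain ⟨hpS, hpo, hpc⟩ := hp (ob s) ⟨s, hs, rfl⟩
    set A := ({u ∈ St | ob u = ob s} : Finset S) with hA
    set π := valueParity A f0 (x (ob s) + 1) with hπ
    have key : valueParity A f (x (ob s) + 1) =
        ∑ u ∈ A, ((if f0 u = x (ob s) + 1 then (1 : ZMod 2) else 0) +
          if u = piv (ob s) then (if π = 1 then 1 else 0) else 0) := by
      refine sum_congr rfl fun u hu ↦ ?_
      have huo : ob u = ob s := by simp [hA] at hu; exact hu.2
      simp only [hf, huo]
      rw [← hA, ← hπ]
      by_cases h1 : u = piv (ob s)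
      · have h3 : f0 u = x (ob s) + 1 := by
          simp only [hf0, huo]; rw [if_pos]; rw [h1, hpc]
        by_cases h2 : π = 1
        · rw [if_pos (show u = piv (ob s) ∧ π = 1 from ⟨h1, h2⟩), if_pos h3, if_pos h1, if_pos h2]
          generalize x (ob s) = a; revert a; decide
        · simp [h1, h2]
      · simp [h1]
    rw [key, sum_add_distrib, sum_ite_eq', if_pos (by simp [hA, hpS, hpo])]
    change π + _ = 0
    generalize π = a; revert a; decide

/-- Exchanging the two admissible values at `p` and at `q`. -/
theorem valueParity_toggle [DecidableEq S] {A : Finset S} {f : S → Fin 3} {x : S → Fin 3}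
    (hf : ∀ u ∈ A, f u ≠ x u) {p q : S} (hpq : p ≠ q) (t : Fin 3) :
    valueParity A (fun u ↦ if u = p ∨ u = q then -(x u + f u) else f u) t =
      valueParity A f t + (if p ∈ A then (if t = x p then 0 else 1) else 0) +
        (if q ∈ A then (if t = x q then 0 else 1) else 0) := by
  have key : valueParity A (fun u ↦ if u = p ∨ u = q then -(x u + f u) else f u) t =
      ∑ u ∈ A, ((if f u = t then (1 : ZMod 2) else 0) +
        (if u = p then (if t = x p then 0 else 1) else 0) +
        (if u = q then (if t = x q then 0 else 1) else 0)) := by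
    refine sum_congr rfl fun u hu ↦ ?_
    have h := hf u hu
    -- Replacing `a` by the other value different from `b` alters the indicator of every `t` except
    -- `b`.
    have aux : ∀ a b t : Fin 3, a ≠ b → (if -(b + a) = t then (1 : ZMod 2) else 0) =
      (if a = t then 1 else 0) + if t = b then 0 else 1 := by decide
    by_cases h1 : u = p
    · subst h1
      simp only [hpq, true_or, if_true, if_false, add_zero]
      exact aux _ _ _ h
    · by_cases h2 : u = q
      · subst h2
        simp only [h1, or_true, if_true, if_false, add_zero]
        exact aux _ _ _ h
      · simp [h1, h2]
  rw [key, sum_add_distrib, sum_add_distrib, sum_ite_eq', sum_ite_eq']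
  rfl

/-- A choice of values avoiding the colours and the values excluded by the objects, which is even on
each object. -/
structure EvenValues (St : Finset S) (c : S → Fin 3) (ob : S → Ω) (x : Ω → Fin 3)
    (f : S → Fin 3) : Prop where
  ne_color : ∀ s ∈ St, f s ≠ c s
  ne_excluded : ∀ s ∈ St, f s ≠ x (ob s)
  even : ∀ ω t, ∀ A : Finset S, (∀ u, u ∈ A ↔ u ∈ St ∧ ob u = ω) → valueParity A f t = 0

/-- Toggling two elements of one object on different sides. -/
theorem EvenValues.toggle {St : Finset S} {c : S → Fin 3} {ob : S → Ω} {x : Ω → Fin 3}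
    {f : S → Fin 3} (hf : EvenValues St c ob x f) {p q : S} (hp : p ∈ St) (hq : q ∈ St)
    (side : S → Bool) (hsp : side p = false) (hsq : side q = true) (hob : ob p = ob q)
    (hcp : c p = x (ob p)) (hcq : c q = x (ob p)) :
    ∃ f', EvenValues St c ob x f' ∧ ∀ t,
      valueParity {u ∈ St | side u = false} f' t =
        valueParity {u ∈ St | side u = false} f t + if t = x (ob p) then 0 else 1 := by
  classical
  have hpq : p ≠ q := by rintro rfl; simp [hsp] at hsq
  have aux : ∀ a b : Fin 3, a ≠ b → -(b + a) ≠ b := by decide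
  refine ⟨fun u ↦ if u = p ∨ u = q then -(x (ob u) + f u) else f u, ⟨?_, ?_, ?_⟩, ?_⟩
  · intro s hs
    split_ifs with h
    · have : c s = x (ob s) := by
        rcases h with rfl | rfl
        · exact hcp
        · rw [hcq, hob]
      rw [this]
      exact aux _ _ (hf.ne_excluded s hs)
    · exact hf.ne_color s hs
  · intro s hs
    split_ifs with h
    · exact aux _ _ (hf.ne_excluded s hs)
    · exact hf.ne_excluded s hs
  · intro ω t A hA
    rw [valueParity_toggle (x := fun u ↦ x (ob u))
      (fun u hu ↦ hf.ne_excluded u ((hA u).1 hu).1) hpq, hf.even ω t A hA]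
    simp only [hA, hp, hq, true_and, hob]
    generalize (if ob q = ω then if t = x (ob q) then (0 : ZMod 2) else 1 else 0) = a
    revert a; decide
  · intro t
    rw [valueParity_toggle (x := fun u ↦ x (ob u))
      (fun u hu ↦ hf.ne_excluded u (mem_filter.1 hu).1) hpq]
    simp [hp, hsp, hsq]

/-- Once the side `false` is even for every value, so is the side `true`. -/
theorem EvenValues.even_side {St : Finset S} {c : S → Fin 3} {ob : S → Ω} {x : Ω → Fin 3}
    {f : S → Fin 3} (hf : EvenValues St c ob x f) {side : S → Bool}
    (h : ∀ t, valueParity {u ∈ St | side u = false} f t = 0) (b : Bool) (t : Fin 3) :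
    valueParity {u ∈ St | side u = b} f t = 0 := by
  classical
  cases b
  · exact h t
  have htot : valueParity St f t = 0 := by
    unfold valueParity
    rw [← sum_fiberwise_of_maps_to (t := St.image ob) (g := ob)
      (fun i hi ↦ mem_image_of_mem _ hi)]
    exact sum_eq_zero fun ω _ ↦ hf.even ω t _ (by simp)
  have hsplit : valueParity St f t = valueParity {u ∈ St | side u = true} f t +
      valueParity {u ∈ St | side u = false} f t := by
    unfold valueParity
    rw [← sum_filter_add_sum_filter_not St (fun u ↦ side u = true)]
    simp
  rw [htot, h t, add_zero] at hsplit
  exact hsplit.symm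

/-- `exists_even_values` with parities stated for every finset describing an object, so that
decidability instances and empty objects cause no friction. -/
theorem EvenValues.exists_of_pivots {St : Finset S} {c : S → Fin 3} {ob : S → Ω} {x : Ω → Fin 3}
    (hpiv : ∀ s ∈ St, ∃ p ∈ St, ob p = ob s ∧ c p = x (ob s))
    (hev : ∀ ω, ∀ A : Finset S, (∀ u, u ∈ A ↔ u ∈ St ∧ ob u = ω) → Even #A) :
    ∃ f, EvenValues St c ob x f := by
  classical
  obtain ⟨f, h1, h2⟩ := exists_even_values St c ob x hpiv (fun s _ ↦ hev (ob s) _ (by simp))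
  refine ⟨f, fun s hs ↦ (h1 s hs).1, fun s hs ↦ (h1 s hs).2, fun ω t A hA ↦ ?_⟩
  obtain rfl | ⟨s, hs⟩ := A.eq_empty_or_nonempty
  · simp [valueParity]
  obtain ⟨hsS, rfl⟩ := (hA s).1 hs
  convert h2 s hsS t using 2
  ext u; simp [hA]

/-- Two linked objects with pivots of different colours allow to make every value even. -/
theorem exists_even_side_of_two {St : Finset S} {c : S → Fin 3} {ob : S → Ω} {side : S → Bool}
    (hob : ∀ ω, ∀ A : Finset S, (∀ u, u ∈ A ↔ u ∈ St ∧ ob u = ω) → Even #A)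
    (hside : Even #{u ∈ St | side u = false})
    {p q p' q' : S} (hp : p ∈ St) (hq : q ∈ St) (hp' : p' ∈ St) (hq' : q' ∈ St)
    (sp : side p = false) (sq : side q = true) (sp' : side p' = false) (sq' : side q' = true)
    (hpq : ob p = ob q) (hpq' : ob p' = ob q') (hne : ob p ≠ ob p')
    (hc : c p = c q) (hc' : c p' = c q') (hcc : c p ≠ c p') :
    ∃ x f, EvenValues St c ob x f ∧ ∀ b t, valueParity {u ∈ St | side u = b} f t = 0 := by
  classical
  have hx : ∀ ω, ∃ i, (ω = ob p → i = c p) ∧ (ω = ob p' → i = c p') ∧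
      ((∃ s ∈ St, ob s = ω) → ∃ s ∈ St, ob s = ω ∧ c s = i) := by
    intro ω
    by_cases h1 : ω = ob p
    · exact ⟨c p, by simp, fun h ↦ absurd (h1.symm.trans h) hne, fun _ ↦ ⟨p, hp, h1.symm, rfl⟩⟩
    by_cases h2 : ω = ob p'
    · exact ⟨c p', fun h ↦ absurd h h1, by simp, fun _ ↦ ⟨p', hp', h2.symm, rfl⟩⟩
    by_cases h3 : ∃ s ∈ St, ob s = ω
    · obtain ⟨s, hs, hso⟩ := h3
      exact ⟨c s, fun h ↦ absurd h h1, fun h ↦ absurd h h2, fun _ ↦ ⟨s, hs, hso, rfl⟩⟩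
    · exact ⟨0, fun h ↦ absurd h h1, fun h ↦ absurd h h2, fun h ↦ absurd h h3⟩
  choose x hxp hxp' hxs using hx
  obtain ⟨f, hf⟩ := EvenValues.exists_of_pivots (x := x) (c := c)
    (fun s hs ↦ hxs (ob s) ⟨s, hs, rfl⟩) hob
  have e1 : c p = x (ob p) := (hxp _ rfl).symm
  have e2 : c p' = x (ob p') := (hxp' _ rfl).symm
  obtain ⟨f1, hf1, g1⟩ := hf.toggle hp hq side sp sq hpq e1 (hc ▸ e1)
  obtain ⟨f2, hf2, g2⟩ := hf.toggle hp' hq' side sp' sq' hpq' e2 (hc' ▸ e2)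
  obtain ⟨f3, hf3, g3⟩ := hf1.toggle hp' hq' side sp' sq' hpq' e2 (hc' ▸ e2)
  rw [← e1] at g1
  rw [← e2] at g2 g3
  have hsum := valueParity_sum {u ∈ St | side u = false} f
  rw [(ZMod.natCast_eq_zero_iff_even).2 hside] at hsum
  -- Parity vectors with sum zero form a group of order four. The two toggles add the vectors
  -- vanishing only at `i` and only at `j`, which generate it.
  have dec : ∀ v : Fin 3 → ZMod 2, v 0 + v 1 + v 2 = 0 → ∀ i j : Fin 3, i ≠ j →
      (∀ t, v t = 0) ∨ (∀ t, v t + (if t = i then 0 else 1) = 0) ∨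
      (∀ t, v t + (if t = j then 0 else 1) = 0) ∨
      (∀ t, v t + (if t = i then 0 else 1) + (if t = j then 0 else 1) = 0) := by decide
  rcases dec _ hsum _ _ hcc with h | h | h | h
  · exact ⟨x, f, hf, hf.even_side h⟩
  · exact ⟨x, f1, hf1, hf1.even_side fun t ↦ (g1 t).trans (h t)⟩
  · exact ⟨x, f2, hf2, hf2.even_side fun t ↦ (g2 t).trans (h t)⟩
  · exact ⟨x, f3, hf3, hf3.even_side fun t ↦ by rw [g3, g1]; exact h t⟩

/-- If all linked objects have an element of colour `a`, and one of them has elements of colour `a`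
on both sides, then every value can be made even. -/
theorem exists_even_side_of_common {St : Finset S} {c : S → Fin 3} {ob : S → Ω} {side : S → Bool}
    (hob : ∀ ω, ∀ A : Finset S, (∀ u, u ∈ A ↔ u ∈ St ∧ ob u = ω) → Even #A)
    (hside : Even #{u ∈ St | side u = false}) (a : Fin 3)
    (hcom : ∀ p ∈ St, ∀ q ∈ St, side p = false → side q = true → ob p = ob q →
      ∃ r ∈ St, ob r = ob p ∧ c r = a)
    (hpq : (∃ p ∈ St, ∃ q ∈ St, side p = false ∧ side q = true ∧ ob p = ob q) →
      ∃ p ∈ St, ∃ q ∈ St, side p = false ∧ side q = true ∧ ob p = ob q ∧ c p = a ∧ c q = a) :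
    ∃ x f, EvenValues St c ob x f ∧ ∀ b t, valueParity {u ∈ St | side u = b} f t = 0 := by
  classical
  have hx : ∀ ω, ∃ i, (∀ p ∈ St, ∀ q ∈ St, side p = false → side q = true → ob p = ob q →
      ob p = ω → i = a) ∧ ((∃ s ∈ St, ob s = ω) → ∃ s ∈ St, ob s = ω ∧ c s = i) := by
    intro ω
    by_cases h1 : ∃ p ∈ St, ∃ q ∈ St, side p = false ∧ side q = true ∧ ob p = ob q ∧ ob p = ω
    · obtain ⟨p, hp, q, hq, sp, sq, h, rfl⟩ := h1
      exact ⟨a, fun _ _ _ _ _ _ _ _ ↦ rfl, fun _ ↦ hcom p hp q hq sp sq h⟩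
    by_cases h3 : ∃ s ∈ St, ob s = ω
    · obtain ⟨s, hs, hso⟩ := h3
      exact ⟨c s, fun p hp q hq sp sq h h' ↦ absurd ⟨p, hp, q, hq, sp, sq, h, h'⟩ h1,
        fun _ ↦ ⟨s, hs, hso, rfl⟩⟩
    · exact ⟨0, fun p hp q hq sp sq h h' ↦ absurd ⟨p, hp, q, hq, sp, sq, h, h'⟩ h1,
        fun h ↦ absurd h h3⟩
  choose x hxa hxs using hx
  obtain ⟨f, hf⟩ := EvenValues.exists_of_pivots (x := x) (c := c)
    (fun s hs ↦ hxs (ob s) ⟨s, hs, rfl⟩) hob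
  -- An object on one side contributes nothing, a linked one avoids the value `a`.
  have local_zero : ∀ ω t, t = a ∨
      (¬ ∃ p ∈ St, ∃ q ∈ St, side p = false ∧ side q = true ∧ ob p = ob q ∧ ob p = ω) →
      valueParity {u ∈ ({u ∈ St | side u = false} : Finset S) | ob u = ω} f t = 0 := by
    intro ω t h
    by_cases h1 : ∃ p ∈ St, ∃ q ∈ St, side p = false ∧ side q = true ∧ ob p = ob q ∧ ob p = ω
    · obtain rfl := h.resolve_right (not_not_intro h1)
      refine valueParity_eq_zero_of_forall_ne fun u hu ↦ ?_
      obtain ⟨p, hp, q, hq, sp, sq, h', rfl⟩ := h1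
      simp only [mem_filter] at hu
      rw [← hxa _ p hp q hq sp sq h' rfl, ← hu.2]
      exact hf.ne_excluded u hu.1.1
    · by_cases h2 : ∃ p ∈ St, side p = false ∧ ob p = ω
      · obtain ⟨p, hp, sp, hpo⟩ := h2
        refine hf.even ω t _ fun u ↦ ?_
        simp only [mem_filter]
        refine ⟨fun hu ↦ ⟨hu.1.1, hu.2⟩, fun hu ↦ ⟨⟨hu.1, ?_⟩, hu.2⟩⟩
        by_contra hs
        exact h1 ⟨p, hp, u, hu.1, sp, by simpa using hs, hpo.trans hu.2.symm, hpo⟩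
      · have : ({u ∈ ({u ∈ St | side u = false} : Finset S) | ob u = ω} : Finset S) = ∅ := by
          refine eq_empty_of_forall_notMem fun u hu ↦ h2 ?_
          simp only [mem_filter] at hu
          exact ⟨u, hu.1.1, hu.1.2, hu.2⟩
        rw [this]; simp [valueParity]
  have total : ∀ t, valueParity {u ∈ St | side u = false} f t =
      ∑ ω ∈ St.image ob,
        valueParity {u ∈ ({u ∈ St | side u = false} : Finset S) | ob u = ω} f t := by
    intro t
    unfold valueParity
    rw [← sum_fiberwise_of_maps_to (t := St.image ob) (g := ob)
      (fun i hi ↦ mem_image_of_mem _ (mem_filter.1 hi).1)]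
  by_cases hl : ∃ p ∈ St, ∃ q ∈ St, side p = false ∧ side q = true ∧ ob p = ob q
  · obtain ⟨p, hp, q, hq, sp, sq, hpq, hcp, hcq⟩ := hpq hl
    have e1 : x (ob p) = a := hxa _ p hp q hq sp sq hpq rfl
    obtain ⟨f1, hf1, g1⟩ := hf.toggle hp hq side sp sq hpq (hcp.trans e1.symm) (hcq.trans e1.symm)
    rw [e1] at g1
    have ha : valueParity {u ∈ St | side u = false} f a = 0 := by
      rw [total]; exact sum_eq_zero fun ω _ ↦ local_zero ω a (.inl rfl)
    have hsum := valueParity_sum {u ∈ St | side u = false} f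
    rw [(ZMod.natCast_eq_zero_iff_even).2 hside] at hsum
    -- With the entry at `a` already zero, only one nonzero parity vector is possible, and a single
    -- toggle cancels it.
    have dec : ∀ v : Fin 3 → ZMod 2, v 0 + v 1 + v 2 = 0 → ∀ i : Fin 3, v i = 0 →
      (∀ t, v t = 0) ∨ (∀ t, v t + (if t = i then 0 else 1) = 0) := by decide
    rcases dec _ hsum _ ha with h | h
    · exact ⟨x, f, hf, hf.even_side h⟩
    · exact ⟨x, f1, hf1, hf1.even_side fun t ↦ (g1 t).trans (h t)⟩
  · refine ⟨x, f, hf, hf.even_side fun t ↦ ?_⟩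
    rw [total]
    refine sum_eq_zero fun ω _ ↦ local_zero ω t (.inr ?_)
    rintro ⟨p, hp, q, hq, sp, sq, h, -⟩
    exact hl ⟨p, hp, q, hq, sp, sq, h⟩

theorem exists_perm_of_ne {i j i' j' : Fin 3} (h : i ≠ j) (h' : i' ≠ j') :
    ∃ σ : Equiv.Perm (Fin 3), σ i' = i ∧ σ j' = j := by
  revert i j i' j'; decide

/-- Elements with a colour and one of two sides are distributed over objects. If all objects and
both sides are even, then, after permuting the colours on each side, values can be assigned which
differ from the colours, omit one value on each object, and are taken an even number of times on
each object and on each side. -/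
theorem exists_perm_evenValues {St : Finset S} {col : S → Fin 3} {ob : S → Ω} {side : S → Bool}
    (hob : ∀ ω, ∀ A : Finset S, (∀ u, u ∈ A ↔ u ∈ St ∧ ob u = ω) → Even #A)
    (hside : Even #{u ∈ St | side u = false}) :
    ∃ (σ : Bool → Equiv.Perm (Fin 3)) (x : Ω → Fin 3) (f : S → Fin 3),
      EvenValues St (fun s ↦ σ (side s) (col s)) ob x f ∧
      ∀ b t, valueParity {u ∈ St | side u = b} f t = 0 := by
  classical
  by_cases hcom : ∃ τ a, ∀ p ∈ St, ∀ q ∈ St, side p = false → side q = true → ob p = ob q →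
      ∃ r ∈ St, ob r = ob p ∧ side r = τ ∧ col r = a
  · obtain ⟨τ, a, h⟩ := hcom
    by_cases hl : ∃ p ∈ St, ∃ q ∈ St, side p = false ∧ side q = true ∧ ob p = ob q
    · obtain ⟨p, hp, q, hq, sp, sq, hpq⟩ := hl
      obtain ⟨r, hr, hro, sr, hra⟩ := h p hp q hq sp sq hpq
      -- an element on the other side
      obtain ⟨r', hr', hro', sr'⟩ : ∃ r' ∈ St, ob r' = ob p ∧ side r' = !τ := by
        cases τ
        · exact ⟨q, hq, hpq.symm, sq⟩
        · exact ⟨p, hp, rfl, sp⟩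
      -- Side `τ` keeps its colors; the other side is recolored so that one linked object shows `a`
      -- on both sides.
      let σ : Bool → Equiv.Perm (Fin 3) := fun b ↦ if b = τ then 1 else Equiv.swap a (col r')
      have σr : σ τ a = a := by simp [σ]
      have σr' : σ (!τ) (col r') = a := by cases τ <;> simp [σ]
      refine ⟨σ, exists_even_side_of_common hob hside a ?_ fun _ ↦ ?_⟩
      · intro p hp q hq sp sq hpq
        obtain ⟨r, hr, hro, sr, hra⟩ := h p hp q hq sp sq hpq
        exact ⟨r, hr, hro, by rw [sr, hra, σr]⟩
      · have cr : σ (side r) (col r) = a := by rw [sr, hra, σr]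
        have cr' : σ (side r') (col r') = a := by rw [sr', σr']
        cases τ
        · exact ⟨r, hr, r', hr', sr, sr', hro.trans hro'.symm, cr, cr'⟩
        · exact ⟨r', hr', r, hr, sr', sr, hro'.trans hro.symm, cr', cr⟩
    · refine ⟨fun _ ↦ 1, exists_even_side_of_common hob hside 0 ?_ ?_⟩
      · exact fun p hp q hq sp sq hpq ↦ absurd ⟨p, hp, q, hq, sp, sq, hpq⟩ hl
      · exact fun h ↦ absurd h hl
  · have diag : ∃ p ∈ St, ∃ q ∈ St, ∃ p' ∈ St, ∃ q' ∈ St, side p = false ∧ side q = true ∧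
        side p' = false ∧ side q' = true ∧ ob p = ob q ∧ ob p' = ob q' ∧ ob p ≠ ob p' ∧
        col p ≠ col p' ∧ col q ≠ col q' := by
      push Not at hcom
      -- Any linked object will do here, so the color `0` is arbitrary. The next two objects are
      -- chosen to lack `col p0` on side `false` and `col q0` on side `true`, respectively. If
      -- neither of them pairs with the first object, they pair with each other.
      obtain ⟨p0, hp0, q0, hq0, sp0, sq0, h0, -⟩ := hcom true 0
      obtain ⟨p1, hp1, q1, hq1, sp1, sq1, h1, n1⟩ := hcom false (col p0)
      obtain ⟨p2, hp2, q2, hq2, sp2, sq2, h2, n2⟩ := hcom true (col q0)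
      have o1 : ob p0 ≠ ob p1 := fun h ↦ n1 p0 hp0 h sp0 rfl
      have o2 : ob p0 ≠ ob p2 := fun h ↦ n2 q0 hq0 (h0.symm.trans h) sq0 rfl
      have c1 : col p1 ≠ col p0 := n1 p1 hp1 rfl sp1
      have c2 : col q2 ≠ col q0 := n2 q2 hq2 h2.symm sq2
      by_cases d1 : col q0 = col q1
      · by_cases d2 : col p0 = col p2
        · exact ⟨p1, hp1, q1, hq1, p2, hp2, q2, hq2, sp1, sq1, sp2, sq2, h1, h2,
            fun h ↦ n1 p2 hp2 h.symm sp2 d2.symm, d2 ▸ c1, fun h ↦ c2 (h.symm.trans d1.symm)⟩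
        · exact ⟨p0, hp0, q0, hq0, p2, hp2, q2, hq2, sp0, sq0, sp2, sq2, h0, h2, o2, d2, c2.symm⟩
      · exact ⟨p0, hp0, q0, hq0, p1, hp1, q1, hq1, sp0, sq0, sp1, sq1, h0, h1, o1, c1.symm, d1⟩
    obtain ⟨p, hp, q, hq, p', hp', q', hq', sp, sq, sp', sq', ho, ho', hne, cp, cq⟩ := diag
    -- Recoloring side `true` by `ρ` makes the two pivots of each of the two objects agree in color.
    obtain ⟨ρ, hρ, hρ'⟩ := exists_perm_of_ne cp cq
    refine ⟨fun b ↦ if b then ρ else 1, ?_⟩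
    exact exists_even_side_of_two hob hside hp hq hp' hq' sp sq sp' sq' ho ho' hne
      (by simp [sp, sq, hρ]) (by simp [sp', sq', hρ']) (by simp [sp, sp', cp])

end TypeAssignment

/-! ### Walks inside an edge set, boundaries modulo 2 and T-joins. -/

namespace Graph

variable {α β : Type*} {G : Graph α β}

/-- `u` and `v` are joined by a walk with edges in `X`. -/
def Reach (G : Graph α β) (X : Set β) : α → α → Prop :=
  Relation.ReflTransGen fun u v ↦ ∃ e ∈ X, G.IsLink e u v

theorem Reach.refl (X : Set β) (u : α) : G.Reach X u u := Relation.ReflTransGen.refl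

theorem Reach.trans {X : Set β} {u v w : α} (h : G.Reach X u v) (h' : G.Reach X v w) :
    G.Reach X u w := Relation.ReflTransGen.trans h h'

theorem Reach.symm {X : Set β} {u v : α} (h : G.Reach X u v) : G.Reach X v u := by
  induction h with
  | refl => exact Reach.refl _ _
  | tail _ h ih =>
    obtain ⟨e, he, hl⟩ := h
    exact Relation.ReflTransGen.head ⟨e, he, hl.symm⟩ ih

theorem IsLink.reach {X : Set β} {e : β} {u v : α} (h : G.IsLink e u v) (he : e ∈ X) :
    G.Reach X u v := Relation.ReflTransGen.single ⟨e, he, h⟩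

theorem Reach.mono {X Y : Set β} {u v : α} (h : G.Reach X u v) (hXY : X ⊆ Y) : G.Reach Y u v := by
  induction h with
  | refl => exact Reach.refl _ _
  | tail _ h ih =>
    obtain ⟨e, he, hl⟩ := h
    exact ih.trans (hl.reach (hXY he))

theorem Reach.mem_of_closed {X : Set β} {u v : α} (h : G.Reach X u v) {A : Set α} (hu : u ∈ A)
    (hA : ∀ e ∈ X, ∀ x y, G.IsLink e x y → x ∈ A → y ∈ A) : v ∈ A := by
  induction h with
  | refl => exact hu
  | tail _ h ih =>
    obtain ⟨e, he, hl⟩ := h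
    exact hA e he _ _ hl ih

/-- The equivalence relation of being joined by a walk with edges in `X`. -/
def reachSetoid (G : Graph α β) (X : Set β) : Setoid α :=
  ⟨G.Reach X, Reach.refl X, Reach.symm, Reach.trans⟩

open Classical in
/-- The sum modulo 2 of the values of `J` on the edges at `v`; here `E` contains all edges. -/
noncomputable def boundary (G : Graph α β) (E : Finset β) (J : β → ZMod 2) (v : α) : ZMod 2 :=
  ∑ e ∈ E, if G.Inc e v then J e else 0

theorem boundary_add (E : Finset β) (J J' : β → ZMod 2) (v : α) :
    G.boundary E (J + J') v = G.boundary E J v + G.boundary E J' v := by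
  unfold boundary
  rw [← Finset.sum_add_distrib]
  exact Finset.sum_congr rfl fun e _ ↦ by split_ifs <;> simp

theorem boundary_sum {ι : Type*} (E : Finset β) (A : Finset ι) (J : ι → β → ZMod 2) (v : α) :
    G.boundary E (∑ i ∈ A, J i) v = ∑ i ∈ A, G.boundary E (J i) v := by
  classical
  induction A using Finset.induction_on with
  | empty => simp [boundary]
  | insert a A ha ih => rw [Finset.sum_insert ha, Finset.sum_insert ha, boundary_add, ih]

theorem IsLink.inc_iff {e : β} {u v w : α} (h : G.IsLink e u v) :
    G.Inc e w ↔ w = u ∨ w = v :=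
  ⟨fun hw ↦ hw.eq_or_eq_of_isLink h, by
    rintro (rfl | rfl)
    exacts [h.inc_left, h.inc_right]⟩

open Classical in
theorem IsLink.ite_inc [G.Loopless] {e : β} {u v : α} (h : G.IsLink e u v) (w : α) (a : ZMod 2) :
    (if G.Inc e w then a else 0) = (if w = u then a else 0) + (if w = v then a else 0) := by
  have hne := h.ne
  rw [h.inc_iff]
  by_cases h1 : w = u
  · subst h1; simp [hne]
  · simp [h1]

-- Adding up the edges of a walk modulo 2 cancels all its inner vertices.
open Classical in
theorem Reach.exists_join [G.Loopless] {E : Finset β} (hE : ∀ e ∈ E(G), e ∈ E) {X : Set β}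
    {u v : α} (h : G.Reach X u v) :
    ∃ J : β → ZMod 2, (∀ e ∉ X, J e = 0) ∧
      ∀ w, G.boundary E J w = (if w = u then 1 else 0) + (if w = v then 1 else 0) := by
  induction h with
  | refl =>
    refine ⟨0, fun _ _ ↦ rfl, fun w ↦ ?_⟩
    have : G.boundary E 0 w = 0 := by simp [boundary]
    rw [this]; split_ifs <;> decide
  | @tail b c _ h ih =>
    obtain ⟨J, hJ, hb⟩ := ih
    obtain ⟨e, he, hl⟩ := h
    refine ⟨J + Pi.single e 1, fun f hf ↦ ?_, fun w ↦ ?_⟩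
    · have : f ≠ e := by rintro rfl; exact hf he
      simp [hJ f hf, this]
    · have : G.boundary E (Pi.single e 1) w = if G.Inc e w then 1 else 0 := by
        unfold boundary
        rw [Finset.sum_eq_single_of_mem e (hE e hl.edge_mem)]
        · simp
        · intro f _ hf; simp [hf]
      rw [boundary_add, hb, this, hl.ite_inc]
      have : ∀ x y z : ZMod 2, x + y + (y + z) = x + z := by decide
      exact this _ _ _

open Classical in
/-- A set `T` of vertices which is even on each component of `X` is the boundary of a subset of
`X`. -/
theorem exists_join [G.Loopless] {E : Finset β} (hE : ∀ e ∈ E(G), e ∈ E) (X : Set β)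
    (T : Finset α) (hT : ∀ u ∈ T, Even (T.filter (G.Reach X u)).card) :
    ∃ J : β → ZMod 2, (∀ e ∉ X, J e = 0) ∧ ∀ w, G.boundary E J w = if w ∈ T then 1 else 0 := by
  -- Each vertex of `T` is joined to a fixed root of its component; the contributions at the root
  -- cancel because `T` is even there.
  let r : α → α := fun v ↦ (Quotient.mk (G.reachSetoid X) v).out
  have hr : ∀ v, G.Reach X v (r v) := fun v ↦
    (Quotient.exact (Quotient.out_eq (Quotient.mk (G.reachSetoid X) v))).symm
  have hreq : ∀ u v, G.Reach X u v → r u = r v := fun u v h ↦ by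
    simp only [r]; rw [Quotient.sound (s := G.reachSetoid X) h]
  choose J hJ hb using fun v ↦ (hr v).exists_join hE
  refine ⟨∑ v ∈ T, J v, fun e he ↦ ?_, fun w ↦ ?_⟩
  · rw [Finset.sum_apply]; exact Finset.sum_eq_zero fun v _ ↦ hJ v e he
  · rw [boundary_sum]
    simp only [hb, Finset.sum_add_distrib, Finset.sum_ite_eq]
    rw [Finset.sum_boole, (ZMod.natCast_eq_zero_iff_even).2, add_zero]
    by_cases h : ∃ u ∈ T, w = r u
    · obtain ⟨u, hu, rfl⟩ := h
      convert hT u hu using 3 with v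
      exact ⟨fun h ↦ ((hr u).trans (h ▸ (hr v).symm)), fun h ↦ hreq _ _ h⟩
    · have : T.filter (fun u ↦ w = r u) = ∅ :=
        Finset.filter_eq_empty_iff.2 fun u hu h' ↦ h ⟨u, hu, h'⟩
      simp [this]

/-- The handshake lemma modulo 2 for a vertex set closed under the support of `J`. -/
theorem sum_boundary_eq_zero [G.Loopless] (E : Finset β) (J : β → ZMod 2) (A : Finset α)
    (hA : ∀ e u v, J e ≠ 0 → G.IsLink e u v → u ∈ A → v ∈ A) :
    ∑ v ∈ A, G.boundary E J v = 0 := by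
  classical
  unfold boundary
  rw [Finset.sum_comm]
  refine Finset.sum_eq_zero fun e _ ↦ ?_
  by_cases hJ : J e = 0
  · simp [hJ]
  by_cases he : e ∈ E(G)
  · obtain ⟨u, v, hl⟩ := exists_isLink_of_mem_edgeSet he
    simp only [hl.ite_inc, Finset.sum_add_distrib, Finset.sum_ite_eq']
    have : u ∈ A ↔ v ∈ A := ⟨hA e u v hJ hl, hA e v u hJ hl.symm⟩
    by_cases hu : u ∈ A
    · simp only [hu, this.1 hu, if_true]
      generalize J e = a; revert a; decide
    · simp [hu, this.not.1 hu]
  · refine Finset.sum_eq_zero fun v _ ↦ if_neg fun h ↦ he h.edge_mem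

/-- The boundary at a vertex with exactly three edges. -/
theorem boundary_eq_of_incidenceSet {E : Finset β} (hE : ∀ e ∈ E(G), e ∈ E) {v : α} {a b c : β}
    (hab : a ≠ b) (hac : a ≠ c) (hbc : b ≠ c) (h : G.incidenceSet v = {a, b, c})
    (J : β → ZMod 2) : G.boundary E J v = J a + J b + J c := by
  classical
  have hi : ∀ e, G.Inc e v ↔ e = a ∨ e = b ∨ e = c := fun e ↦ by
    rw [← mem_incidenceSet, h]; simp
  unfold boundary
  rw [← Finset.sum_filter]
  have : E.filter (fun e ↦ G.Inc e v) = {a, b, c} := by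
    ext e
    simp only [Finset.mem_filter, Finset.mem_insert, Finset.mem_singleton, hi e]
    exact ⟨fun h ↦ h.2, fun h ↦ ⟨hE e ((hi e).2 h).edge_mem, h⟩⟩
  rw [this, Finset.sum_insert (by simp [hab, hac]), Finset.sum_insert (by simp [hbc]),
    Finset.sum_singleton, add_assoc]

end Graph

/-! ### Components of an edge set, and even edge sets as cycle double covers. -/

namespace Graph

variable {α β : Type*} {G : Graph α β}

/-- The component containing `u` of the graph formed by the edges in `X`. -/
def part (G : Graph α β) (X : Set β) (u : α) : Graph α β :=
  (G.restrict X).induce {v | G.Reach X u v}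

theorem mem_part {X : Set β} {u v : α} : v ∈ V(G.part X u) ↔ G.Reach X u v := Iff.rfl

theorem part_isLink {X : Set β} {u x y : α} {e : β} :
    (G.part X u).IsLink e x y ↔ e ∈ X ∧ G.IsLink e x y ∧ G.Reach X u x := by
  simp only [part, induce_isLink, restrict_isLink, Set.mem_ofPred_eq]
  exact ⟨fun h ↦ ⟨h.1.1, h.1.2, h.2.1⟩,
    fun h ↦ ⟨⟨h.1, h.2.1⟩, h.2.2, h.2.2.trans (h.2.1.reach h.1)⟩⟩

theorem part_inc {X : Set β} {u x : α} {e : β} :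
    (G.part X u).Inc e x ↔ e ∈ X ∧ G.Inc e x ∧ G.Reach X u x := by
  simp only [Inc, part_isLink]
  tauto

theorem mem_edgeSet_part {X : Set β} {u : α} {e : β} :
    e ∈ E(G.part X u) ↔ e ∈ X ∧ ∃ x, G.Inc e x ∧ G.Reach X u x := by
  constructor
  · intro h
    obtain ⟨x, y, hl⟩ := exists_isLink_of_mem_edgeSet h
    obtain ⟨h1, h2, h3⟩ := part_isLink.1 hl
    exact ⟨h1, x, h2.inc_left, h3⟩
  · rintro ⟨h, x, hx, hr⟩
    exact (part_inc.2 ⟨h, hx, hr⟩).edge_mem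

theorem Reach.mem {X : Set β} {u v : α} (h : G.Reach X u v) (hu : u ∈ V(G)) : v ∈ V(G) :=
  h.mem_of_closed hu fun _ _ _ _ hl _ ↦ hl.right_mem

theorem part_le {X : Set β} {u : α} (hu : u ∈ V(G)) : G.part X u ≤ G where
  vertexSet_mono := fun _ hv ↦ (mem_part.1 hv).mem hu
  isLink_mono := fun _ _ _ h ↦ (part_isLink.1 h).2.1

theorem part_eq_of_reach {X : Set β} {u v : α} (h : G.Reach X u v) : G.part X u = G.part X v := by
  refine Graph.ext ?_ fun e x y ↦ ?_
  · ext w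
    exact ⟨fun hw ↦ h.symm.trans hw, fun hw ↦ h.trans hw⟩
  · simp only [part_isLink]
    exact ⟨fun hw ↦ ⟨hw.1, hw.2.1, h.symm.trans hw.2.2⟩, fun hw ↦ ⟨hw.1, hw.2.1, h.trans hw.2.2⟩⟩

theorem part_isConnected (X : Set β) (u : α) : (G.part X u).IsConnected := by
  have key : ∀ {x}, G.Reach X u x → Relation.ReflTransGen (G.part X u).Adj u x := by
    intro x hx
    induction hx with
    | refl => exact Relation.ReflTransGen.refl
    | tail hb h ih =>
      obtain ⟨e, he, hl⟩ := h
      exact ih.tail ⟨e, part_isLink.2 ⟨he, hl, hb⟩⟩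
  refine ⟨⟨u, Reach.refl X u⟩, fun x hx y hy ↦ ?_⟩
  exact (Relation.ReflTransGen.stdSymm.symm _ _ (key hx)).trans (key hy)

theorem IsFinite.mono {H : Graph α β} (hG : G.IsFinite) (h : H ≤ G) : H.IsFinite :=
  ⟨hG.1.subset h.vertexSet_mono, hG.2.subset h.edgeSet_mono⟩

theorem degree_eq_ncard [G.Loopless] (x : α) : G.degree x = (G.incidenceSet x).ncard := by
  have : G.loopSet x = ∅ := by
    ext e; simp
  rw [degree, this, Set.ncard_empty, add_zero]

theorem part_isCycle [hl : G.Loopless] (hG : G.IsFinite) {X : Set β} {u : α} (hu : u ∈ V(G))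
    (h : ∀ v, G.Reach X u v → {e | e ∈ X ∧ G.Inc e v}.ncard = 2) : (G.part X u).IsCycle := by
  have hll : (G.part X u).Loopless := Loopless.anti (part_le hu)
  refine ⟨hG.mono (part_le hu), hll, part_isConnected X u, fun x hx ↦ ?_⟩
  rw [degree_eq_ncard, ← h x hx]
  congr 1
  ext e
  simp only [mem_incidenceSet, part_inc, Set.mem_ofPred_eq]
  exact ⟨fun h ↦ ⟨h.1, h.2.1⟩, fun h ↦ ⟨h.1, h.2, hx⟩⟩

/-- In a cubic graph, `k` even edge sets covering every edge twice give a `k`-cycle double cover. -/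
theorem hasCycleDoubleCover_of_even_sets [G.Loopless] (hG : G.IsFinite) (hc : G.IsCubic) {k : ℕ} [NeZero k]
    (Z : Fin k → Set β)
    (hdeg : ∀ i, ∀ v ∈ V(G), (∃ e ∈ Z i, G.Inc e v) → {e | e ∈ Z i ∧ G.Inc e v}.ncard = 2)
    (hcov : ∀ e ∈ E(G), {i | e ∈ Z i}.ncard = 2) : G.HasCycleDoubleCover k := by
  classical
  have hfinI : ∀ v, (G.incidenceSet v).Finite := fun v ↦
    hG.2.subset (G.incidenceSet_subset_edgeSet v)
  have hI : ∀ v ∈ V(G), (G.incidenceSet v).ncard = 3 := fun v hv ↦ by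
    rw [← degree_eq_ncard]; exact hc v hv
  -- every vertex of a component meets its edge set
  have hmeet : ∀ i e x v, e ∈ Z i → G.Inc e x → G.Reach (Z i) x v → ∃ f ∈ Z i, G.Inc f v := by
    intro i e x v he hx hr
    obtain rfl | ⟨b, -, f, hf, hl⟩ := Relation.ReflTransGen.cases_tail hr
    · exact ⟨e, he, hx⟩
    · exact ⟨f, hf, hl.inc_right⟩
  -- components of different edge sets are different
  have hdist : ∀ i j e x, e ∈ Z i → e ∈ Z j → G.Inc e x → G.part (Z i) x = G.part (Z j) x →
      i = j := by
    intro i j e x hi hj hx hij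
    by_contra hne
    have hxV := hx.vertex_mem
    have hA : ∀ f, (f ∈ Z i ∧ G.Inc f x) ↔ (f ∈ Z j ∧ G.Inc f x) := by
      intro f
      have := part_inc (G := G) (X := Z i) (u := x) (x := x) (e := f)
      rw [hij, part_inc] at this
      simpa [Reach.refl] using this.symm
    have hAi := hdeg i x hxV ⟨e, hi, hx⟩
    -- If two classes shared a cycle, the set of cycles would count it once. The third edge `c` at
    -- `x` lies in another class `Z l`, which uses two of the three edges at `x` and so meets the
    -- two edges of the shared cycle; the common edge would be covered three times.
    obtain ⟨c, hcI, hcA⟩ : ∃ c ∈ G.incidenceSet x, c ∉ {e | e ∈ Z i ∧ G.Inc e x} := by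
      by_contra! hcon
      have := Set.ncard_le_ncard (s := G.incidenceSet x) hcon
        ((hfinI x).subset fun f hf ↦ hf.2)
      rw [hI x hxV, hAi] at this
      omega
    obtain ⟨l, hl⟩ : {l | c ∈ Z l}.Nonempty := by
      rw [Set.nonempty_iff_ne_empty]
      intro h
      have := hcov c (Inc.edge_mem hcI)
      rw [h] at this
      simp at this
    have hli : l ≠ i := by rintro rfl; exact hcA ⟨hl, hcI⟩
    have hlj : l ≠ j := by rintro rfl; exact hcA ((hA c).2 ⟨hl, hcI⟩)
    have hAl := hdeg l x hxV ⟨c, hl, hcI⟩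
    have hint : ({e | e ∈ Z i ∧ G.Inc e x} ∩ {e | e ∈ Z l ∧ G.Inc e x}).Nonempty := by
      rw [Set.nonempty_iff_ne_empty]
      intro h
      have h1 := Set.ncard_union_eq (Set.disjoint_iff_inter_eq_empty.2 h)
        ((hfinI x).subset fun f hf ↦ hf.2) ((hfinI x).subset fun f hf ↦ hf.2)
      have h2 := Set.ncard_le_ncard (s := {e | e ∈ Z i ∧ G.Inc e x} ∪ {e | e ∈ Z l ∧ G.Inc e x})
        (t := G.incidenceSet x) (by rintro f (hf | hf) <;> exact hf.2) (hfinI x)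
      rw [hI x hxV] at h2
      omega
    obtain ⟨d, ⟨hd1, hdx⟩, hd2, -⟩ := hint
    have hd3 := ((hA d).1 ⟨hd1, hdx⟩).1
    have h3 : ({i, j, l} : Set (Fin k)) ⊆ {i | d ∈ Z i} := by
      rintro m (rfl | rfl | rfl)
      exacts [hd1, hd3, hd2]
    have h4 := Set.ncard_le_ncard h3 (Set.toFinite _)
    rw [hcov d hdx.edge_mem, Set.ncard_eq_three.2 ⟨i, j, l, hne, hli.symm, hlj.symm, rfl⟩] at h4
    omega
  -- a component is determined by any of its edges
  have hdet : ∀ i e x y f, e ∈ Z i → G.Inc e x → f ∈ E(G.part (Z i) x) → G.Inc f y →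
      f ∈ Z i ∧ G.part (Z i) x = G.part (Z i) y := by
    intro i e x y f he hx hf hy
    obtain ⟨hfi, w, hw, hr⟩ := mem_edgeSet_part.1 hf
    refine ⟨hfi, part_eq_of_reach (hr.trans ?_)⟩
    obtain ⟨w', hl⟩ := hw
    rcases hl.inc_iff.1 hy with rfl | rfl
    · exact Reach.refl _ _
    · exact hl.reach hfi
  let S : Set (Graph α β) := {C | ∃ i, ∃ e ∈ Z i, ∃ x, G.Inc e x ∧ C = G.part (Z i) x}
  -- Graphs outside `S` receive the irrelevant class `0`, available since `k` is nonzero.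
  have hcls : ∀ C : Graph α β, ∃ i : Fin k, C ∈ S → ∃ e ∈ Z i, ∃ x, G.Inc e x ∧
      C = G.part (Z i) x := by
    intro C
    by_cases h : C ∈ S
    · obtain ⟨i, h⟩ := h
      exact ⟨i, fun _ ↦ h⟩
    · exact ⟨0, fun h' ↦ absurd h' h⟩
  choose cls hcls using hcls
  refine ⟨S, ⟨?_, fun e he ↦ ?_⟩, cls, fun C hC D hD hCD h ↦ ?_⟩
  · rintro C ⟨i, e, he, x, hx, rfl⟩
    refine ⟨part_le hx.vertex_mem, part_isCycle hG hx.vertex_mem fun v hv ↦ ?_⟩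
    exact hdeg i v (hv.mem hx.vertex_mem) (hmeet i e x v he hx hv)
  · obtain ⟨x, y, hl⟩ := exists_isLink_of_mem_edgeSet he
    have hx := hl.inc_left
    obtain ⟨i, j, hij, hset⟩ := Set.ncard_eq_two.1 (hcov e he)
    have hmem : ∀ l, e ∈ Z l ↔ l = i ∨ l = j := fun l ↦ by
      have := Set.ext_iff.1 hset l
      simpa using this
    have : {C | C ∈ S ∧ e ∈ E(C)} = {G.part (Z i) x, G.part (Z j) x} := by
      ext C
      constructor
      · rintro ⟨⟨l, f, hf, w, hw, rfl⟩, heC⟩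
        obtain ⟨hel, heq⟩ := hdet l f w x e hf hw heC hx
        rw [heq]
        rcases (hmem l).1 hel with rfl | rfl
        · exact .inl rfl
        · exact .inr rfl
      · have : ∀ l, e ∈ Z l → G.part (Z l) x ∈ {C | C ∈ S ∧ e ∈ E(C)} := fun l hel ↦
          ⟨⟨l, e, hel, x, hx, rfl⟩, mem_edgeSet_part.2 ⟨hel, x, hx, Reach.refl _ _⟩⟩
        rintro (rfl | rfl)
        · exact this i ((hmem i).2 (.inl rfl))
        · exact this j ((hmem j).2 (.inr rfl))
    rw [this, Set.encard_pair]
    exact fun h ↦ hij (hdist i j e x ((hmem i).2 (.inl rfl)) ((hmem j).2 (.inr rfl)) hx h)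
  · obtain ⟨e, he, x, hx, hCe⟩ := hcls C hC
    obtain ⟨f, hf, y, hy, hDe⟩ := hcls D hD
    rw [← h] at hf hDe
    rw [Set.disjoint_left]
    intro d hdC hdD
    obtain ⟨w, w', hl⟩ : ∃ w w', G.IsLink d w w' := by
      rw [hCe] at hdC
      obtain ⟨-, w, ⟨w', hl⟩, -⟩ := mem_edgeSet_part.1 hdC
      exact ⟨w, w', hl⟩
    apply hCD
    rw [hCe] at hdC
    rw [hDe] at hdD
    rw [hCe, hDe, (hdet _ e x w d he hx hdC hl.inc_left).2, (hdet _ f y w d hf hy hdD hl.inc_left).2]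

end Graph

/-! ### Frame colorings of cycles and of subdivided Kotzig graphs. -/

namespace Graph

variable {α β : Type*} {G L : Graph α β}

theorem exists_eq_triple_of_ncard {I : Set β} (h : I.ncard = 3) {a b : β} (ha : a ∈ I) (hb : b ∈ I)
    (hab : a ≠ b) : ∃ d, a ≠ d ∧ b ≠ d ∧ I = {a, b, d} := by
  have hsub : ({a, b} : Set β) ⊆ I := by rintro x (rfl | rfl) <;> assumption
  have h1 : (I \ {a, b}).ncard = 1 := by
    rw [Set.ncard_sdiff hsub, h, Set.ncard_pair hab]
  obtain ⟨d, hd⟩ := Set.ncard_eq_one.1 h1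
  have hdm : d ∈ I \ {a, b} := by rw [hd]; rfl
  refine ⟨d, fun h ↦ hdm.2 (by simp [h]), fun h ↦ hdm.2 (by simp [h]), ?_⟩
  rw [← Set.sdiff_union_of_subset hsub, hd]
  ext x; simp

theorem incidenceSet_eq_triple {v : α} (h : (G.incidenceSet v).ncard = 3) {a b d : β}
    (ha : G.Inc a v) (hb : G.Inc b v) (hd : G.Inc d v) (hab : a ≠ b) (had : a ≠ d) (hbd : b ≠ d) :
    G.incidenceSet v = {a, b, d} := by
  obtain ⟨d', -, -, h'⟩ := exists_eq_triple_of_ncard h ha hb hab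
  have : d ∈ G.incidenceSet v := hd
  rw [h'] at this
  rcases this with rfl | rfl | rfl
  · exact absurd rfl had
  · exact absurd rfl hbd
  · exact h'

theorem IsCubic.ncard_incidenceSet [G.Loopless] (h : G.IsCubic) {v : α} (hv : v ∈ V(G)) :
    (G.incidenceSet v).ncard = 3 := by
  rw [← degree_eq_ncard]; exact h v hv

/-- The edge colouring `c` of the subgraph `L` of the cubic graph `G` looks like the colouring of a
subdivided Kotzig graph or a constant colouring of a cycle: vertices of degree `3` see all colours,
vertices of degree `2` only one, and for every colour `i` the edges with other colours form a
connected graph. -/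
structure IsFrameColoring (G L : Graph α β) (c : β → Fin 3) : Prop where
  exists_triple : ∀ v ∈ V(L), ∃ a b d, a ≠ b ∧ a ≠ d ∧ b ≠ d ∧ G.incidenceSet v = {a, b, d} ∧
    a ∈ E(L) ∧ b ∈ E(L) ∧
      ((d ∈ E(L) ∧ c a ≠ c b ∧ c a ≠ c d ∧ c b ≠ c d) ∨ (d ∉ E(L) ∧ c a = c b))
  reach : ∀ i u v a b, G.Inc a u → a ∈ E(L) → c a ≠ i → G.Inc b v → b ∈ E(L) → c b ≠ i →
    G.Reach {e | e ∈ E(L) ∧ c e ≠ i} u v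

/-- A constant coloring works with any color `j`; this freedom later lets a cycle adopt the type
excluded by its object. -/
theorem IsFrameColoring.of_isCycle [G.Loopless] (hG : G.IsCubic) (hL : L ≤ G) (hC : L.IsCycle)
    (j : Fin 3) : IsFrameColoring G L (fun _ ↦ j) := by
  have hll : L.Loopless := Loopless.anti hL
  constructor
  · intro v hv
    have h2 := hC.regular v hv
    rw [degree_eq_ncard] at h2
    obtain ⟨a, b, hab, hset⟩ := Set.ncard_eq_two.1 h2
    have hi : ∀ e, L.Inc e v ↔ e = a ∨ e = b := fun e ↦ by
      rw [← mem_incidenceSet, hset]; rfl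
    have ha := (hi a).2 (.inl rfl)
    have hb := (hi b).2 (.inr rfl)
    obtain ⟨d, had, hbd, hI⟩ := exists_eq_triple_of_ncard
      (hG.ncard_incidenceSet (hL.vertexSet_mono hv)) (ha.mono hL) (hb.mono hL) hab
    refine ⟨a, b, d, hab, had, hbd, hI, ha.edge_mem, hb.edge_mem, .inr ⟨fun hd ↦ ?_, rfl⟩⟩
    have hdG : G.Inc d v := by rw [← mem_incidenceSet, hI]; simp
    rcases (hi d).1 ((hL.inc_congr hd).2 hdG) with rfl | rfl
    · exact had rfl
    · exact hbd rfl
  · intro i u v a b hau haL hai hbv hbL _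
    have hu := ((hL.inc_congr haL).2 hau).vertex_mem
    have hv := ((hL.inc_congr hbL).2 hbv).vertex_mem
    have := hC.connected.2 u hu v hv
    clear hbv hv
    induction this with
    | refl => exact Reach.refl _ _
    | tail _ h ih =>
      obtain ⟨e, hl⟩ := h
      exact ih.trans ((hl.mono hL).reach ⟨hl.edge_mem, hai⟩)

theorem IsPathBetween.exists_inc_left {P : Graph α β} {v w : α} (h : P.IsPathBetween v w)
    (hvw : v ≠ w) : ∃ f, P.Inc f v := by
  obtain ⟨n, p, q, -, -, hv, hw, -, -, hl⟩ := h
  have hn : 0 < n := by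
    rcases Nat.eq_zero_or_pos n with rfl | h
    · exact absurd (hv.symm.trans hw) hvw
    · exact h
  exact ⟨q 0, hv ▸ (hl 0 hn).inc_left⟩

theorem IsPathBetween.reach {P : Graph α β} {v w x : α} (h : P.IsPathBetween v w) (hP : P ≤ G)
    (hx : x ∈ V(P)) : G.Reach E(P) v x := by
  obtain ⟨n, p, q, -, -, rfl, -, hV, -, hl⟩ := h
  rw [hV] at hx
  obtain ⟨i, hi, rfl⟩ := hx
  induction i with
  | zero => exact Reach.refl _ _
  | succ i ih =>
    have hi' : i < n := hi
    exact (ih hi'.le).trans (((hl i hi').mono hP).reach (hl i hi').edge_mem)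

theorem IsPathBetween.exists_pair {P : Graph α β} {v w x : α} (h : P.IsPathBetween v w)
    (hx : x ∈ V(P)) (hxv : x ≠ v) (hxw : x ≠ w) :
    ∃ a b, a ≠ b ∧ P.Inc a x ∧ P.Inc b x ∧ ∀ f, P.Inc f x → f = a ∨ f = b := by
  obtain ⟨n, p, q, hp, hq, rfl, rfl, hV, hE, hl⟩ := h
  rw [hV] at hx
  obtain ⟨i, hi, rfl⟩ := hx
  have hi' : i ≤ n := hi
  obtain ⟨j, rfl⟩ := Nat.exists_eq_succ_of_ne_zero (fun h : i = 0 ↦ hxv (by rw [h]))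
  have hn : j + 1 < n := lt_of_le_of_ne hi' (fun h ↦ hxw (by rw [← h]))
  have hj : j < n := by omega
  refine ⟨q j, q (j + 1), fun h ↦ ?_, (hl j hj).inc_right, (hl (j + 1) hn).inc_left, fun f hf ↦ ?_⟩
  · have := hq (Set.mem_Iio.2 hj) (Set.mem_Iio.2 hn) h
    omega
  · have hfE := hf.edge_mem
    rw [hE] at hfE
    obtain ⟨k, hk, rfl⟩ := hfE
    have hk' : k < n := hk
    rcases (hl k hk').inc_iff.1 hf with h | h
    · have := hp hi (Set.mem_Iic.2 hk'.le) h
      right; rw [← this]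
    · have := hp hi (Set.mem_Iic.2 (show k + 1 ≤ n from hk')) h
      left; congr 1; omega

/-- Three distinct colors meet at `v`, so color `i` occurs there exactly once. -/
theorem IsKotzigColoring.ncard_ne [hl : G.Loopless] (hG : G.IsCubic) {c : β → Fin 3}
    (hc : G.IsKotzigColoring c) {v : α} (hv : v ∈ V(G)) (i : Fin 3) :
    {e | e ∈ {e | c e ≠ i} ∧ G.Inc e v}.ncard = 2 := by
  obtain ⟨a, b, d, hab, had, hbd, hI⟩ := Set.ncard_eq_three.1 (hG.ncard_incidenceSet hv)
  have hi : ∀ e, G.Inc e v ↔ e = a ∨ e = b ∨ e = d := fun e ↦ by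
    rw [← mem_incidenceSet, hI]; simp
  have ha := (hi a).2 (by simp)
  have hb := (hi b).2 (by simp)
  have hd := (hi d).2 (by simp)
  have c1 := hc.1 ha hb hab
  have c2 := hc.1 ha hd had
  have c3 := hc.1 hb hd hbd
  have dec : ∀ x y z i : Fin 3, x ≠ y → x ≠ z → y ≠ z → x = i ∨ y = i ∨ z = i := by decide
  rw [Set.ncard_eq_two]
  rcases dec _ _ _ i c1 c2 c3 with h | h | h
  · refine ⟨b, d, hbd, ?_⟩
    ext e
    simp only [Set.mem_ofPred_eq, hi, Set.mem_insert_iff, Set.mem_singleton_iff, ← h]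
    constructor
    · rintro ⟨h1, rfl | h2⟩
      · exact absurd rfl h1
      · exact h2
    · rintro (rfl | rfl)
      exacts [⟨c1.symm, by simp⟩, ⟨c2.symm, by simp⟩]
  · refine ⟨a, d, had, ?_⟩
    ext e
    simp only [Set.mem_ofPred_eq, hi, Set.mem_insert_iff, Set.mem_singleton_iff, ← h]
    constructor
    · rintro ⟨h1, h2 | rfl | h2⟩
      · exact .inl h2
      · exact absurd rfl h1
      · exact .inr h2
    · rintro (rfl | rfl)
      exacts [⟨c1, by simp⟩, ⟨c3.symm, by simp⟩]
  · refine ⟨a, b, hab, ?_⟩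
    ext e
    simp only [Set.mem_ofPred_eq, hi, Set.mem_insert_iff, Set.mem_singleton_iff, ← h]
    constructor
    · rintro ⟨h1, h2 | h2 | rfl⟩
      · exact .inl h2
      · exact .inr h2
      · exact absurd rfl h1
    · rintro (rfl | rfl)
      exacts [⟨c2, by simp⟩, ⟨c3, by simp⟩]

/-- In a Kotzig graph the edges of any two colours connect all vertices. -/
theorem IsKotzigColoring.reach (hK : G.IsKotzigGraph) {c : β → Fin 3}
    (hc : G.IsKotzigColoring c) {u v : α} (hu : u ∈ V(G)) (hv : v ∈ V(G)) (i : Fin 3) :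
    G.Reach {e | c e ≠ i} u v := by
  have := hK.loopless
  -- The two-colored component of `u` is a bicolored cycle, hence hamiltonian, so it reaches `v`.
  have hcyc : (G.part {e | c e ≠ i} u).IsCycle :=
    part_isCycle hK.isFinite hu fun w hw ↦ hc.ncard_ne hK.cubic (hw.mem hu) i
  have := hc.2 _ (part_le hu) hcyc ⟨i, fun e he ↦ (mem_edgeSet_part.1 he).1⟩
  rw [← this] at hv
  exact hv

/-- Every edge of a replacing path inherits the color of the edge it replaces. A vertex of `K` keeps
its three colors, an inner path vertex sees one, and walks of `K` avoiding a color expand along the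
paths. -/
theorem IsFrameColoring.exists_of_isKotzigSubdivision [G.Loopless] (hG : G.IsCubic) (hL : L ≤ G)
    (hS : L.IsKotzigSubdivision) : ∃ c, IsFrameColoring G L c := by
  classical
  obtain ⟨K, hK, P, hP, hPV, hPd, hV, hE, -⟩ := hS
  obtain ⟨c, hc⟩ := hK.exists_coloring
  have := hK.loopless
  have hPG : ∀ {e}, e ∈ E(K) → P e ≤ G := fun he ↦ by
    obtain ⟨v, w, hl⟩ := exists_isLink_of_mem_edgeSet he
    exact (hP hl).1.trans hL
  have huniq : ∀ {e e' f}, e ∈ E(K) → e' ∈ E(K) → f ∈ E(P e) → f ∈ E(P e') → e = e' := by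
    intro e e' f he he' hf hf'
    by_contra hne
    exact Set.disjoint_left.1 (hPd e he e' he' hne).1 hf hf'
  -- The paths are edge-disjoint, so the inherited color is well defined.
  have hex : ∀ f, ∃ i, ∀ e ∈ E(K), f ∈ E(P e) → i = c e := by
    intro f
    by_cases h : ∃ e ∈ E(K), f ∈ E(P e)
    · obtain ⟨e, he, hf⟩ := h
      exact ⟨c e, fun e' he' hf' ↦ by rw [huniq he he' hf hf']⟩
    · exact ⟨0, fun e he hf ↦ absurd ⟨e, he, hf⟩ h⟩
  choose col hcol using hex
  have hmemL : ∀ f, f ∈ E(L) ↔ ∃ e ∈ E(K), f ∈ E(P e) := fun f ↦ by rw [hE]; simp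
  refine ⟨col, ?_, ?_⟩
  · intro v hv
    by_cases hvK : v ∈ V(K)
    · obtain ⟨e₁, e₂, e₃, h12, h13, h23, hI⟩ :=
        Set.ncard_eq_three.1 (hK.cubic.ncard_incidenceSet hvK)
      have hi : ∀ e, K.Inc e v ↔ e = e₁ ∨ e = e₂ ∨ e = e₃ := fun e ↦ by
        rw [← mem_incidenceSet, hI]; simp
      have hedge : ∀ e, K.Inc e v → ∃ f, f ∈ E(P e) ∧ G.Inc f v := by
        rintro e ⟨w, hl⟩
        obtain ⟨f, hf⟩ := (hP hl).2.exists_inc_left hl.ne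
        exact ⟨f, hf.edge_mem, hf.mono (hPG hl.edge_mem)⟩
      have i₁ := (hi e₁).2 (by simp)
      have i₂ := (hi e₂).2 (by simp)
      have i₃ := (hi e₃).2 (by simp)
      obtain ⟨f₁, m₁, g₁⟩ := hedge _ i₁
      obtain ⟨f₂, m₂, g₂⟩ := hedge _ i₂
      obtain ⟨f₃, m₃, g₃⟩ := hedge _ i₃
      have n12 : f₁ ≠ f₂ := fun h ↦ h12 (huniq i₁.edge_mem i₂.edge_mem m₁ (h ▸ m₂))
      have n13 : f₁ ≠ f₃ := fun h ↦ h13 (huniq i₁.edge_mem i₃.edge_mem m₁ (h ▸ m₃))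
      have n23 : f₂ ≠ f₃ := fun h ↦ h23 (huniq i₂.edge_mem i₃.edge_mem m₂ (h ▸ m₃))
      refine ⟨f₁, f₂, f₃, n12, n13, n23, incidenceSet_eq_triple
        (hG.ncard_incidenceSet g₁.vertex_mem) g₁ g₂ g₃ n12 n13 n23,
        (hmemL _).2 ⟨_, i₁.edge_mem, m₁⟩, (hmemL _).2 ⟨_, i₂.edge_mem, m₂⟩,
        .inl ⟨(hmemL _).2 ⟨_, i₃.edge_mem, m₃⟩, ?_⟩⟩
      rw [hcol _ _ i₁.edge_mem m₁, hcol _ _ i₂.edge_mem m₂, hcol _ _ i₃.edge_mem m₃]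
      exact ⟨hc.1 i₁ i₂ h12, hc.1 i₁ i₃ h13, hc.1 i₂ i₃ h23⟩
    · obtain ⟨e, he, hve⟩ : ∃ e ∈ E(K), v ∈ V(P e) := by
        rw [hV] at hv
        simpa [hvK] using hv
      obtain ⟨x, y, hl⟩ := exists_isLink_of_mem_edgeSet he
      obtain ⟨a, b, hab, ha, hb, honly⟩ := (hP hl).2.exists_pair hve
        (fun h ↦ hvK (h ▸ hl.left_mem)) (fun h ↦ hvK (h ▸ hl.right_mem))
      have ha' := ha.mono (hPG he)
      have hb' := hb.mono (hPG he)
      obtain ⟨d, had, hbd, hI⟩ := exists_eq_triple_of_ncard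
        (hG.ncard_incidenceSet ha'.vertex_mem) ha' hb' hab
      refine ⟨a, b, d, hab, had, hbd, hI, (hmemL _).2 ⟨e, he, ha.edge_mem⟩,
        (hmemL _).2 ⟨e, he, hb.edge_mem⟩, .inr ⟨fun hd ↦ ?_, ?_⟩⟩
      · have hdG : G.Inc d v := by rw [← mem_incidenceSet, hI]; simp
        obtain ⟨e', he', hde'⟩ := (hmemL d).1 hd
        have hdP := ((hPG he').inc_congr hde').2 hdG
        by_cases hee : e = e'
        · subst hee
          rcases honly d hdP with rfl | rfl
          · exact had rfl
          · exact hbd rfl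
        · exact hvK ((hPd e he e' he' hee).2 ⟨hve, hdP.vertex_mem⟩)
      · rw [hcol _ _ he ha.edge_mem, hcol _ _ he hb.edge_mem]
  · intro i u v a b hau haL hai hbv hbL hbi
    set X : Set β := {e | e ∈ E(L) ∧ col e ≠ i} with hX
    have hPX : ∀ e ∈ E(K), c e ≠ i → E(P e) ⊆ X := fun e he hei f hf ↦
      ⟨(hmemL f).2 ⟨e, he, hf⟩, by rw [hcol f e he hf]; exact hei⟩
    have hend : ∀ a u, G.Inc a u → a ∈ E(L) → col a ≠ i → ∃ x ∈ V(K), G.Reach X x u := by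
      intro a u hau haL hai
      obtain ⟨e, he, hae⟩ := (hmemL a).1 haL
      rw [hcol a e he hae] at hai
      obtain ⟨x, y, hl⟩ := exists_isLink_of_mem_edgeSet he
      refine ⟨x, hl.left_mem, ((hP hl).2.reach (hPG he) ?_).mono (hPX e he hai)⟩
      exact (((hPG he).inc_congr hae).2 hau).vertex_mem
    obtain ⟨x, hx, hxu⟩ := hend a u hau haL hai
    obtain ⟨y, hy, hyv⟩ := hend b v hbv hbL hbi
    refine (hxu.symm.trans ?_).trans hyv
    have hKr := hc.reach hK hx hy i
    clear hyv hy
    induction hKr with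
    | refl => exact Reach.refl _ _
    | tail _ h ih =>
      obtain ⟨e, hei, hl⟩ := h
      refine ih.trans (((hP hl).2.reach (hPG hl.edge_mem) ?_).mono (hPX e hl.edge_mem hei))
      obtain ⟨f, hf⟩ := (hP hl.symm).2.exists_inc_left hl.symm.ne
      exact hf.vertex_mem

end Graph

/-! ### From types to the six even sets. -/

namespace Graph

variable {α β : Type*} {G : Graph α β}

theorem ncard_eq_two_of_triple {v : α} {Z : Set β} {a b d : β} (hab : a ≠ b) (had : a ≠ d)
    (hbd : b ≠ d) (hI : G.incidenceSet v = {a, b, d}) (hne : ∃ e ∈ Z, G.Inc e v)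
    (h : (a ∉ Z ∧ b ∉ Z ∧ d ∉ Z) ∨ (a ∈ Z ∧ b ∈ Z ∧ d ∉ Z) ∨ (a ∈ Z ∧ b ∉ Z ∧ d ∈ Z) ∨
      (a ∉ Z ∧ b ∈ Z ∧ d ∈ Z)) : {e | e ∈ Z ∧ G.Inc e v}.ncard = 2 := by
  have hi : ∀ e, G.Inc e v ↔ e = a ∨ e = b ∨ e = d := fun e ↦ by
    rw [← mem_incidenceSet, hI]; simp
  rw [Set.ncard_eq_two]
  simp only [hi] at hne ⊢
  rcases h with ⟨ha, hb, hd⟩ | ⟨ha, hb, hd⟩ | ⟨ha, hb, hd⟩ | ⟨ha, hb, hd⟩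
  · obtain ⟨e, he, rfl | rfl | rfl⟩ := hne <;> contradiction
  · refine ⟨a, b, hab, ?_⟩
    ext e
    constructor
    · rintro ⟨he, rfl | rfl | rfl⟩
      exacts [.inl rfl, .inr rfl, absurd he hd]
    · rintro (rfl | rfl)
      exacts [⟨ha, .inl rfl⟩, ⟨hb, .inr (.inl rfl)⟩]
  · refine ⟨a, d, had, ?_⟩
    ext e
    constructor
    · rintro ⟨he, rfl | rfl | rfl⟩
      exacts [.inl rfl, absurd he hb, .inr rfl]
    · rintro (rfl | rfl)
      exacts [⟨ha, .inl rfl⟩, ⟨hd, .inr (.inr rfl)⟩]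
  · refine ⟨b, d, hbd, ?_⟩
    ext e
    constructor
    · rintro ⟨he, rfl | rfl | rfl⟩
      exacts [absurd he ha, .inl rfl, .inr rfl]
    · rintro (rfl | rfl)
      exacts [⟨hb, .inr (.inl rfl)⟩, ⟨hd, .inr (.inr rfl)⟩]

/-- The local check at a vertex with all three edges in `D`: one edge excludes `t`, and the other
two have equal `J`, so they enter the class `s` together or not at all. -/
theorem two_of_three_distinct : ∀ xa xb xd t : Fin 3, xa ≠ xb → xa ≠ xd → xb ≠ xd →
    ∀ Ja Jb Jd s : ZMod 2, (xa = t → Ja = 0) → (xb = t → Jb = 0) → (xd = t → Jd = 0) →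
    Ja + Jb + Jd = 0 →
    (¬ (xa ≠ t ∧ Ja = s) ∧ ¬ (xb ≠ t ∧ Jb = s) ∧ ¬ (xd ≠ t ∧ Jd = s)) ∨
    ((xa ≠ t ∧ Ja = s) ∧ (xb ≠ t ∧ Jb = s) ∧ ¬ (xd ≠ t ∧ Jd = s)) ∨
    ((xa ≠ t ∧ Ja = s) ∧ ¬ (xb ≠ t ∧ Jb = s) ∧ (xd ≠ t ∧ Jd = s)) ∨
    (¬ (xa ≠ t ∧ Ja = s) ∧ (xb ≠ t ∧ Jb = s) ∧ (xd ≠ t ∧ Jd = s)) := by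
  intro xa xb xd t h1 h2 h3 Ja Jb Jd s ha hb hd hsum
  have dec : ∀ x y z t : Fin 3, x ≠ y → x ≠ z → y ≠ z → x = t ∨ y = t ∨ z = t := by decide
  have add_eq : ∀ a b : ZMod 2, a + b = 0 → b = a := by decide
  rcases dec _ _ _ t h1 h2 h3 with rfl | rfl | rfl
  · rw [ha rfl, zero_add] at hsum
    obtain rfl := add_eq _ _ hsum
    by_cases hs : Jd = s <;> simp [hs, h1.symm, h2.symm]
  · rw [hb rfl, add_zero] at hsum
    obtain rfl := add_eq _ _ hsum
    by_cases hs : Jd = s <;> simp [hs, h1, h3.symm]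
  · rw [hd rfl, add_zero] at hsum
    obtain rfl := add_eq _ _ hsum
    by_cases hs : Jb = s <;> simp [hs, h2, h3]

/-- The local check at an end of a matching edge: when the matching edge has type `t`, its two
neighbors are split between the two classes; otherwise they stay together. -/
theorem two_of_three_of_eq : ∀ x t fd : Fin 3, fd ≠ x →
    ∀ Ja Jb s : ZMod 2, (x = t → Ja = 0) → (x = t → Jb = 0) →
    Ja + Jb = (if fd = t then 1 else 0) →
    (¬ (x ≠ t ∧ Ja = s) ∧ ¬ (x ≠ t ∧ Jb = s) ∧ ¬ (fd = t)) ∨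
    ((x ≠ t ∧ Ja = s) ∧ (x ≠ t ∧ Jb = s) ∧ ¬ (fd = t)) ∨
    ((x ≠ t ∧ Ja = s) ∧ ¬ (x ≠ t ∧ Jb = s) ∧ (fd = t)) ∨
    (¬ (x ≠ t ∧ Ja = s) ∧ (x ≠ t ∧ Jb = s) ∧ (fd = t)) := by
  intro x t fd hfx Ja Jb s ha hb hsum
  have add_eq : ∀ a b : ZMod 2, a + b = 0 → b = a := by decide
  have add_ne : ∀ a b s : ZMod 2, a + b = 1 → (a = s ∧ b ≠ s) ∨ (a ≠ s ∧ b = s) := by decide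
  by_cases hft : fd = t
  · subst hft
    rw [if_pos rfl] at hsum
    rcases add_ne _ _ s hsum with ⟨h1, h2⟩ | ⟨h1, h2⟩ <;> simp [h1, h2, hfx.symm]
  · rw [if_neg hft] at hsum
    obtain rfl := add_eq _ _ hsum
    by_cases hs : Jb = s <;> by_cases hx : x = t <;> simp [hs, hx, hft]

/-- A `6`-cycle double cover from a type `f` for every edge outside `D` and an excluded type `x` for
every edge in `D`: the two cycle classes of type `t` share all edges of type `t` outside `D`, and
they split the edges of `D` on which `t` is not excluded. -/
theorem hasCycleDoubleCover_of_types [G.Loopless] (hG : G.IsFinite) (hc : G.IsCubic) (D : Set β)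
    (x f : β → Fin 3)
    (hloc : ∀ v ∈ V(G), ∃ a b d, a ≠ b ∧ a ≠ d ∧ b ≠ d ∧ G.incidenceSet v = {a, b, d} ∧
      a ∈ D ∧ b ∈ D ∧ ((d ∈ D ∧ x a ≠ x b ∧ x a ≠ x d ∧ x b ≠ x d) ∨
        (d ∉ D ∧ x a = x b ∧ f d ≠ x a)))
    (heven : ∀ t, ∀ T : Finset α, (∀ v, v ∈ T ↔ ∃ d ∉ D, G.Inc d v ∧ f d = t) → ∀ u ∈ T,
      ∀ A : Finset α, (∀ v, v ∈ A ↔ v ∈ T ∧ G.Reach {e | e ∈ D ∧ x e ≠ t} u v) → Even A.card) :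
    G.HasCycleDoubleCover 6 := by
  classical
  have hE : ∀ e ∈ E(G), e ∈ hG.2.toFinset := fun e he ↦ by simpa using he
  have hJ : ∀ t, ∃ J : β → ZMod 2, (∀ e, ¬ (e ∈ D ∧ x e ≠ t) → J e = 0) ∧
      ∀ w, G.boundary hG.2.toFinset J w = if ∃ d ∉ D, G.Inc d w ∧ f d = t then 1 else 0 := by
    intro t
    set T : Finset α := hG.1.toFinset.filter fun v ↦ ∃ d ∉ D, G.Inc d v ∧ f d = t with hT
    have hmem : ∀ v, v ∈ T ↔ ∃ d ∉ D, G.Inc d v ∧ f d = t := fun v ↦ by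
      simp only [hT, Finset.mem_filter, Set.Finite.mem_toFinset, and_iff_right_iff_imp]
      rintro ⟨d, -, hd, -⟩
      exact hd.vertex_mem
    obtain ⟨J, h1, h2⟩ := exists_join hE {e | e ∈ D ∧ x e ≠ t} T
      (fun u hu ↦ heven t T hmem u hu _ (by simp))
    exact ⟨J, h1, fun w ↦ by rw [h2]; simp only [hmem]⟩
  choose J hJ0 hJb using hJ
  -- A class is a type together with one of the two values that a T-join can take.
  let φ : Fin 6 ≃ Fin 3 × ZMod 2 := (finProdFinEquiv (m := 3) (n := 2)).symm
  let Z : Fin 3 → ZMod 2 → Set β := fun t s ↦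
    {e | (e ∉ D ∧ f e = t) ∨ (e ∈ D ∧ x e ≠ t ∧ J t e = s)}
  have hZD : ∀ t s e, e ∈ D → (e ∈ Z t s ↔ x e ≠ t ∧ J t e = s) := fun t s e he ↦ by
    simp [Z, he]
  have hZM : ∀ t s e, e ∉ D → (e ∈ Z t s ↔ f e = t) := fun t s e he ↦ by simp [Z, he]
  refine hasCycleDoubleCover_of_even_sets hG hc (fun k ↦ Z (φ k).1 (φ k).2) ?_ ?_
  · intro k v hv hne
    obtain ⟨a, b, d, hab, had, hbd, hI, ha, hb, h⟩ := hloc v hv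
    refine ncard_eq_two_of_triple hab had hbd hI hne ?_
    generalize (φ k).1 = t
    generalize (φ k).2 = s
    have hbdry := hJb t v
    rw [boundary_eq_of_incidenceSet hE hab had hbd hI] at hbdry
    have hi : ∀ e, G.Inc e v ↔ e = a ∨ e = b ∨ e = d := fun e ↦ by
      rw [← mem_incidenceSet, hI]; simp
    rcases h with ⟨hd, h1, h2, h3⟩ | ⟨hd, h1, h2⟩
    · rw [hZD t s a ha, hZD t s b hb, hZD t s d hd]
      rw [if_neg] at hbdry
      · exact two_of_three_distinct _ _ _ t h1 h2 h3 _ _ _ s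
          (fun h ↦ hJ0 t a fun h' ↦ h'.2 h) (fun h ↦ hJ0 t b fun h' ↦ h'.2 h)
          (fun h ↦ hJ0 t d fun h' ↦ h'.2 h) hbdry
      · rintro ⟨e, he, hev, -⟩
        rcases (hi e).1 hev with rfl | rfl | rfl <;> contradiction
    · rw [hZD t s a ha, hZD t s b hb, hZM t s d hd, ← h1]
      have hTd : (∃ d ∉ D, G.Inc d v ∧ f d = t) ↔ f d = t := by
        constructor
        · rintro ⟨e, he, hev, rfl⟩
          rcases (hi e).1 hev with rfl | rfl | rfl
          · contradiction
          · contradiction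
          · rfl
        · exact fun h ↦ ⟨d, hd, (hi d).2 (by simp), h⟩
      rw [hJ0 t d fun h ↦ hd h.1, add_zero] at hbdry
      simp only [hTd] at hbdry
      exact two_of_three_of_eq _ t _ h2 _ _ s (fun h ↦ hJ0 t a fun h' ↦ h'.2 h)
          (fun h ↦ hJ0 t b fun h' ↦ h'.2 (h1 ▸ h)) hbdry
  · intro e he
    rw [Set.ncard_eq_two]
    by_cases heD : e ∈ D
    · refine ⟨φ.symm (x e + 1, J (x e + 1) e), φ.symm (x e + 2, J (x e + 2) e), ?_, ?_⟩
      · rw [Ne, φ.symm.injective.eq_iff]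
        intro h
        have : x e + 1 = x e + 2 := congrArg Prod.fst h
        clear h
        revert this
        generalize x e = y; revert y; decide
      · ext k
        obtain ⟨⟨t, s⟩, rfl⟩ := φ.symm.surjective k
        simp only [Set.mem_ofPred_eq, Equiv.apply_symm_apply, hZD _ _ e heD, Set.mem_insert_iff,
          Set.mem_singleton_iff, φ.symm.injective.eq_iff, Prod.mk.injEq]
        constructor
        · rintro ⟨h, rfl⟩
          have : ∀ y t : Fin 3, y ≠ t → t = y + 1 ∨ t = y + 2 := by decide
          rcases this _ _ h with rfl | rfl <;> simp
        · have : ∀ y : Fin 3, y ≠ y + 1 ∧ y ≠ y + 2 := by decide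
          rintro (⟨rfl, rfl⟩ | ⟨rfl, rfl⟩)
          exacts [⟨(this _).1, rfl⟩, ⟨(this _).2, rfl⟩]
    · refine ⟨φ.symm (f e, 0), φ.symm (f e, 1), ?_, ?_⟩
      · simp
      · ext k
        obtain ⟨⟨t, s⟩, rfl⟩ := φ.symm.surjective k
        simp only [Set.mem_ofPred_eq, Equiv.apply_symm_apply, hZM _ _ e heD, Set.mem_insert_iff,
          Set.mem_singleton_iff, φ.symm.injective.eq_iff, Prod.mk.injEq]
        have : ∀ s : ZMod 2, s = 0 ∨ s = 1 := by decide
        have := this s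
        tauto

end Graph

/-! ### Parity of the set of ends of matching edges. -/

namespace Graph

variable {α β : Type*} {G : Graph α β}

/-- Every vertex has at least two of its three edges in `D`. -/
def HasTriples (G : Graph α β) (D : Set β) : Prop :=
  ∀ v ∈ V(G), ∃ a b d, a ≠ b ∧ a ≠ d ∧ b ≠ d ∧ G.incidenceSet v = {a, b, d} ∧ a ∈ D ∧ b ∈ D

/-- The vertex `v` has an edge outside `D`. -/
def IsLight (G : Graph α β) (D : Set β) (v : α) : Prop := ∃ d ∉ D, G.Inc d v

theorem HasTriples.unique {D : Set β} (h : G.HasTriples D) {v : α} {d d' : β} (hd : G.Inc d v)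
    (hd' : G.Inc d' v) (hdD : d ∉ D) (hdD' : d' ∉ D) : d = d' := by
  obtain ⟨a, b, e, -, -, -, hI, ha, hb⟩ := h v hd.vertex_mem
  have hi : ∀ e', G.Inc e' v → e' ∉ D → e' = e := fun e' he' heD ↦ by
    rw [← mem_incidenceSet, hI] at he'
    rcases he' with rfl | rfl | rfl
    exacts [absurd ha heD, absurd hb heD, rfl]
  rw [hi d hd hdD, hi d' hd' hdD']

theorem HasTriples.exists_of_isLight {D : Set β} (h : G.HasTriples D) {v : α} {d : β}
    (hd : G.Inc d v) (hdD : d ∉ D) : ∃ a b, a ≠ b ∧ a ≠ d ∧ b ≠ d ∧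
      G.incidenceSet v = {a, b, d} ∧ a ∈ D ∧ b ∈ D := by
  obtain ⟨a, b, e, h1, h2, h3, hI, ha, hb⟩ := h v hd.vertex_mem
  have : d = e := by
    have hd' := hd
    rw [← mem_incidenceSet, hI] at hd'
    rcases hd' with rfl | rfl | rfl
    exacts [absurd ha hdD, absurd hb hdD, rfl]
  subst this
  exact ⟨a, b, h1, h2, h3, hI, ha, hb⟩

open Classical in
theorem HasTriples.boundary_indicator {D : Set β} (h : G.HasTriples D) {E : Finset β}
    (hE : ∀ e ∈ E(G), e ∈ E) {v : α} (hv : v ∈ V(G)) :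
    G.boundary E (fun e ↦ if e ∈ D then 1 else 0) v = 1 + if G.IsLight D v then 1 else 0 := by
  by_cases hl : G.IsLight D v
  · obtain ⟨d, hd, hdv⟩ := id hl
    obtain ⟨a, b, h1, h2, h3, hI, ha, hb⟩ := h.exists_of_isLight hdv hd
    rw [boundary_eq_of_incidenceSet hE h1 h2 h3 hI, if_pos hl]
    simp [ha, hb, hd]
  · obtain ⟨a, b, d, h1, h2, h3, hI, ha, hb⟩ := h v hv
    have hd : d ∈ D := by
      by_contra hd
      exact hl ⟨d, hd, by rw [← mem_incidenceSet, hI]; simp⟩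
    rw [boundary_eq_of_incidenceSet hE h1 h2 h3 hI, if_neg hl]
    simp only [ha, hb, hd, if_true]
    decide

open Classical in
theorem HasTriples.boundary_indicator_compl {D : Set β} (h : G.HasTriples D) {E : Finset β}
    (hE : ∀ e ∈ E(G), e ∈ E) {v : α} (hv : v ∈ V(G)) :
    G.boundary E (fun e ↦ if e ∈ D then 0 else 1) v = if G.IsLight D v then 1 else 0 := by
  by_cases hl : G.IsLight D v
  · obtain ⟨d, hd, hdv⟩ := id hl
    obtain ⟨a, b, h1, h2, h3, hI, ha, hb⟩ := h.exists_of_isLight hdv hd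
    rw [boundary_eq_of_incidenceSet hE h1 h2 h3 hI, if_pos hl]
    simp [ha, hb, hd]
  · obtain ⟨a, b, d, h1, h2, h3, hI, ha, hb⟩ := h v hv
    have hd : d ∈ D := by
      by_contra hd
      exact hl ⟨d, hd, by rw [← mem_incidenceSet, hI]; simp⟩
    rw [boundary_eq_of_incidenceSet hE h1 h2 h3 hI, if_neg hl]
    simp [ha, hb, hd]

open Classical in
/-- An even vertex set closed under `D` contains an even number of vertices with an edge outside
`D`. -/
theorem HasTriples.even_light [G.Loopless] (hG : G.IsFinite) {D : Set β} (h : G.HasTriples D)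
    {A : Finset α} (hAV : ∀ v ∈ A, v ∈ V(G))
    (hA : ∀ e ∈ D, ∀ u v, G.IsLink e u v → u ∈ A → v ∈ A)
    (hev : Even A.card) : Even (A.filter (G.IsLight D)).card := by
  have hE : ∀ e ∈ E(G), e ∈ hG.2.toFinset := fun e he ↦ by simpa using he
  have h0 := sum_boundary_eq_zero hG.2.toFinset (fun e ↦ if e ∈ D then 1 else 0) A
    (fun e u v he ↦ hA e (by by_contra hn; simp [hn] at he) u v)
  rw [Finset.sum_congr rfl fun v hv ↦ h.boundary_indicator hE (hAV v hv), Finset.sum_add_distrib,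
    Finset.sum_const, nsmul_one, (ZMod.natCast_eq_zero_iff_even).2 hev, zero_add] at h0
  exact (even_card_filter_iff A _).2 h0

open Classical in
/-- A vertex set closed under the edges outside `D` contains an even number of vertices with an
edge outside `D`. -/
theorem HasTriples.even_light_of_compl [G.Loopless] (hG : G.IsFinite) {D : Set β}
    (h : G.HasTriples D) {A : Finset α} (hAV : ∀ v ∈ A, v ∈ V(G))
    (hA : ∀ e ∉ D, ∀ u v, G.IsLink e u v → u ∈ A → v ∈ A) :
    Even (A.filter (G.IsLight D)).card := by
  have hE : ∀ e ∈ E(G), e ∈ hG.2.toFinset := fun e he ↦ by simpa using he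
  have h0 := sum_boundary_eq_zero hG.2.toFinset (fun e ↦ if e ∈ D then 0 else 1) A
    (fun e u v he ↦ hA e (by by_contra hn; simp [hn] at he) u v)
  rw [Finset.sum_congr rfl fun v hv ↦ h.boundary_indicator_compl hE (hAV v hv)] at h0
  exact (even_card_filter_iff A _).2 h0

/-- A finite union of even components is even. -/
theorem even_card_of_closed {D : Set β} {A : Finset α}
    (hA : ∀ u v, G.Reach D u v → u ∈ A → v ∈ A)
    (hev : ∀ u ∈ A, ∀ B : Finset α, (∀ v, v ∈ B ↔ G.Reach D u v) → Even B.card) :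
    Even A.card := by
  classical
  let q : α → Quotient (G.reachSetoid D) := fun v ↦ Quotient.mk _ v
  rw [Finset.card_eq_sum_card_image q A]
  refine Finset.even_sum _ fun ω hω ↦ ?_
  obtain ⟨u, hu, rfl⟩ := Finset.mem_image.1 hω
  refine hev u hu _ fun v ↦ ?_
  have hq : q v = q u ↔ G.Reach D v u := Quotient.eq (r := G.reachSetoid D)
  rw [Finset.mem_filter, hq]
  exact ⟨fun h ↦ h.2.symm, fun h ↦ ⟨hA u v h hu, h.symm⟩⟩

end Graph

/-! ### The global construction: objects, stubs and types. -/

namespace Graph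

variable {α β : Type*} {G : Graph α β}

theorem mem_edgeSet_part_iff {D : Set β} {e : β} {v : α} (h : G.Inc e v) :
    e ∈ E(G.part D v) ↔ e ∈ D :=
  ⟨fun he ↦ (mem_edgeSet_part.1 he).1, fun he ↦ mem_edgeSet_part.2 ⟨he, v, h, Reach.refl _ _⟩⟩

theorem hasTriples_of_isFrameColoring {D : Set β}
    (h : ∀ v ∈ V(G), ∃ c, IsFrameColoring G (G.part D v) c) : G.HasTriples D := by
  intro v hv
  obtain ⟨c, hc⟩ := h v hv
  obtain ⟨a, b, d, h1, h2, h3, hI, ha, hb, -⟩ := hc.exists_triple v (Reach.refl _ _)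
  exact ⟨a, b, d, h1, h2, h3, hI, (mem_edgeSet_part.1 ha).1, (mem_edgeSet_part.1 hb).1⟩

/-- Gives each stub a well-defined color. -/
theorem IsFrameColoring.eq_of_isLight {D : Set β} {v : α} {c : β → Fin 3}
    (hc : IsFrameColoring G (G.part D v) c) (hl : G.IsLight D v) {a b : β} (ha : a ∈ D)
    (hb : b ∈ D) (hav : G.Inc a v) (hbv : G.Inc b v) : c a = c b := by
  obtain ⟨a', b', d, h1, h2, h3, hI, ha', hb', h⟩ := hc.exists_triple v (Reach.refl _ _)
  have hi : ∀ e, G.Inc e v ↔ e = a' ∨ e = b' ∨ e = d := fun e ↦ by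
    rw [← mem_incidenceSet, hI]; simp
  rw [mem_edgeSet_part_iff ((hi a').2 (by simp))] at ha'
  rw [mem_edgeSet_part_iff ((hi b').2 (by simp))] at hb'
  rw [mem_edgeSet_part_iff ((hi d).2 (by simp))] at h
  have hd : d ∉ D := by
    obtain ⟨e, he, hev⟩ := hl
    rcases (hi e).1 hev with rfl | rfl | rfl
    exacts [absurd ha' he, absurd hb' he, he]
  have hab : c a' = c b' := by
    rcases h with ⟨h, -⟩ | ⟨-, h⟩
    exacts [absurd h hd, h]
  rcases (hi a).1 hav with rfl | rfl | rfl <;> rcases (hi b).1 hbv with rfl | rfl | rfl <;>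
    first
    | rfl
    | exact hab
    | exact hab.symm
    | contradiction

open Classical in
/-- Suppose that the components of `D` are even, that those which are not cycles have frame
colourings, and that at most two of them are not cycles. Then there is a `6`-cycle double cover. -/
theorem hasCycleDoubleCover_of_frameColorings [G.Loopless] (hG : G.IsFinite) (hc : G.IsCubic)
    (D : Set β) (cyc : Graph α β → Prop) (side : Graph α β → Bool) (col : Graph α β → β → Fin 3)
    (heven : ∀ v ∈ V(G), Even V(G.part D v).ncard)
    (hcol : ∀ v ∈ V(G), ¬ cyc (G.part D v) → IsFrameColoring G (G.part D v) (col (G.part D v)))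
    (hcyc : ∀ v ∈ V(G), cyc (G.part D v) → ∀ j, IsFrameColoring G (G.part D v) (fun _ ↦ j))
    (hside : ∀ u ∈ V(G), ∀ v ∈ V(G), ¬ cyc (G.part D u) → ¬ cyc (G.part D v) →
      side (G.part D u) = side (G.part D v) → G.part D u = G.part D v) :
    G.HasCycleDoubleCover 6 := by
  have hE : ∀ e ∈ E(G), e ∈ hG.2.toFinset := fun e he ↦ by simpa using he
  have hcy : ∀ {u v}, G.Reach D u v → (cyc (G.part D u) ↔ cyc (G.part D v)) := fun h ↦ by
    rw [part_eq_of_reach h]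
  have htri : G.HasTriples D := hasTriples_of_isFrameColoring fun v hv ↦ by
    by_cases h : cyc (G.part D v)
    exacts [⟨_, hcyc v hv h 0⟩, ⟨_, hcol v hv h⟩]
  have hcard : ∀ v ∈ V(G), ∀ B : Finset α, (∀ w, w ∈ B ↔ G.Reach D v w) → Even B.card := by
    intro v hv B hB
    have : V(G.part D v) = ↑B := by ext w; rw [mem_part, Finset.mem_coe, hB]
    have h := heven v hv
    rwa [this, Set.ncard_coe_finset] at h
  have hcycLight : ∀ v ∈ V(G), cyc (G.part D v) → G.IsLight D v := by
    intro v hv h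
    obtain ⟨a, b, d, -, -, -, hI, -, -, h⟩ := (hcyc v hv h 0).exists_triple v (Reach.refl _ _)
    have hd : G.Inc d v := by rw [← mem_incidenceSet, hI]; simp
    rw [mem_edgeSet_part_iff hd] at h
    exact ⟨d, by simpa using h, hd⟩
  -- `Y` drops precisely the edges of the noncyclic components; its components are the objects.
  set Y : Set β := {e | e ∉ D ∨ ∃ u, G.Inc e u ∧ cyc (G.part D u)} with hY
  have hYcyc : ∀ {e u}, e ∈ D → G.Inc e u → (e ∈ Y ↔ cyc (G.part D u)) := by
    intro e u he hu
    refine ⟨?_, fun h ↦ .inr ⟨u, hu, h⟩⟩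
    rintro (h | ⟨w, ⟨w', hl⟩, hw⟩)
    · exact absurd he h
    · rcases hl.inc_iff.1 hu with rfl | rfl
      · exact hw
      · exact (hcy (hl.reach he)).1 hw
  have hDY : ∀ {u v}, G.Reach D u v → cyc (G.part D u) → G.Reach Y u v := by
    intro u v huv hu
    induction huv with
    | refl => exact Reach.refl _ _
    | tail hb h ih =>
      obtain ⟨e, he, hl⟩ := h
      exact ih.trans (hl.reach ((hYcyc he hl.inc_left).2 ((hcy hb).1 hu)))
  set St : Finset α := hG.1.toFinset.filter fun v ↦ ¬ cyc (G.part D v) ∧ G.IsLight D v with hSt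
  have memSt : ∀ v, v ∈ St ↔ v ∈ V(G) ∧ ¬ cyc (G.part D v) ∧ G.IsLight D v := by simp [hSt]
  have hsc : ∀ v, ∃ i, v ∈ St → ∀ a ∈ D, G.Inc a v → col (G.part D v) a = i := by
    intro v
    by_cases hv : v ∈ St
    · obtain ⟨hvG, hvc, hvl⟩ := (memSt v).1 hv
      obtain ⟨a, b, d, -, -, -, hI, ha, -⟩ := htri v hvG
      have hav : G.Inc a v := by rw [← mem_incidenceSet, hI]; simp
      exact ⟨col (G.part D v) a, fun _ e he hev ↦
        (hcol v hvG hvc).eq_of_isLight hvl he ha hev hav⟩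
    · exact ⟨0, fun h ↦ absurd h hv⟩
  choose sc hsc using hsc
  let ob : α → Quotient (G.reachSetoid Y) := fun v ↦ Quotient.mk _ v
  have hob : ∀ {u v}, ob u = ob v ↔ G.Reach Y u v := Quotient.eq (r := G.reachSetoid Y)
  have hobEven : ∀ ω, ∀ A : Finset α, (∀ u, u ∈ A ↔ u ∈ St ∧ ob u = ω) → Even A.card := by
    intro ω A hA
    obtain ⟨w, rfl⟩ := Quotient.exists_rep ω
    let W : Finset α := hG.1.toFinset.filter (G.Reach Y w)
    have memW : ∀ v, v ∈ W ↔ v ∈ V(G) ∧ G.Reach Y w v := by simp [W]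
    have h1 : Even (W.filter (G.IsLight D)).card := by
      refine htri.even_light_of_compl hG (fun v hv ↦ ((memW v).1 hv).1) ?_
      intro e he u v hl hu
      exact (memW v).2 ⟨hl.right_mem, ((memW u).1 hu).2.trans (hl.reach (.inl he))⟩
    have h2 : Even (W.filter fun v ↦ cyc (G.part D v)).card := by
      refine even_card_of_closed (G := G) (D := D) ?_ ?_
      · intro u v huv hu
        simp only [Finset.mem_filter, memW] at hu ⊢
        exact ⟨⟨huv.mem hu.1.1, hu.1.2.trans (hDY huv hu.2)⟩, (hcy huv).1 hu.2⟩
      · intro u hu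
        exact hcard u (((memW u).1 (Finset.mem_filter.1 hu).1).1)
    have h3 := Finset.card_filter_add_card_filter_not (s := W.filter (G.IsLight D))
      (fun v ↦ cyc (G.part D v))
    have h4 : (W.filter (G.IsLight D)).filter (fun v ↦ cyc (G.part D v)) =
        W.filter fun v ↦ cyc (G.part D v) := by
      ext v
      simp only [Finset.mem_filter, memW]
      exact ⟨fun h ↦ ⟨h.1.1, h.2⟩, fun h ↦ ⟨⟨h.1, hcycLight v h.1.1 h.2⟩, h.2⟩⟩
    have h5 : (W.filter (G.IsLight D)).filter (fun v ↦ ¬ cyc (G.part D v)) = A := by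
      ext v
      rw [hA, memSt]
      simp only [Finset.mem_filter, memW]
      rw [show ob v = Quotient.mk _ w ↔ G.Reach Y w v from eq_comm.trans (hob (u := w) (v := v))]
      tauto
    rw [h4, h5] at h3
    rw [← h3, Nat.even_add] at h1
    exact h1.1 h2
  -- If nonempty, this set consists of all light vertices of a single component, which has even
  -- order.
  have hsideEven : Even (St.filter fun u ↦ side (G.part D u) = false).card := by
    obtain h | ⟨w, hw⟩ := (St.filter fun u ↦ side (G.part D u) = false).eq_empty_or_nonempty
    · simp [h]
    rw [Finset.mem_filter, memSt] at hw
    obtain ⟨⟨hwV, hwc, -⟩, hws⟩ := hw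
    let A : Finset α := hG.1.toFinset.filter (G.Reach D w)
    have memA : ∀ v, v ∈ A ↔ G.Reach D w v := fun v ↦ by
      simp only [A, Finset.mem_filter, Set.Finite.mem_toFinset, and_iff_right_iff_imp]
      exact fun h ↦ h.mem hwV
    have := htri.even_light hG (A := A) (fun v hv ↦ ((memA v).1 hv).mem hwV)
      (fun e he u v hl hu ↦ (memA v).2 (((memA u).1 hu).trans (hl.reach he)))
      (hcard w hwV A memA)
    convert this using 2
    ext v
    simp only [Finset.mem_filter, memSt, memA]
    constructor
    · rintro ⟨⟨hvV, hvc, hvl⟩, hvs⟩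
      refine ⟨?_, hvl⟩
      have hp := hside w hwV v hvV hwc hvc (hws.trans hvs.symm)
      rw [← mem_part, hp]
      exact Reach.refl _ _
    · rintro ⟨hr, hvl⟩
      exact ⟨⟨hr.mem hwV, (hcy hr).not.1 hwc, hvl⟩, by rw [← part_eq_of_reach hr, hws]⟩
  obtain ⟨σ, x, f, hf, hfs⟩ := exists_perm_evenValues (St := St) (col := sc) (ob := ob)
    (side := fun v ↦ side (G.part D v)) hobEven hsideEven
  -- the types of the edges outside `D`
  let T : Finset α := St.filter fun v ↦ f v = x (ob v) + 1
  obtain ⟨J, hJ0, hJb⟩ := exists_join hE Y T (by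
    intro u hu
    have h0 := hf.even (ob u) (x (ob u) + 1) (St.filter fun v ↦ ob v = ob u) (by simp)
    rw [valueParity_eq_zero_iff] at h0
    convert h0 using 2
    ext v
    simp only [T, Finset.mem_filter]
    constructor
    · rintro ⟨⟨h1, h2⟩, h3⟩
      have h4 : ob v = ob u := hob.2 h3.symm
      exact ⟨⟨h1, h4⟩, h4 ▸ h2⟩
    · rintro ⟨⟨h1, h4⟩, h2⟩
      exact ⟨⟨h1, h4.symm ▸ h2⟩, hob.1 h4.symm⟩)
  have hreach : ∀ {e u v}, e ∈ D → G.Inc e u → G.Inc e v → G.Reach D u v := by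
    rintro e u v he ⟨w, hl⟩ hv
    rcases hl.inc_iff.1 hv with rfl | rfl
    exacts [Reach.refl _ _, hl.reach he]
  have hreachY : ∀ {e u v}, e ∈ Y → G.Inc e u → G.Inc e v → ob u = ob v := by
    rintro e u v he ⟨w, hl⟩ hv
    rcases hl.inc_iff.1 hv with rfl | rfl
    exacts [rfl, hob.2 (hl.reach he)]
  have hτ : ∀ e, ∃ t, ∀ v, e ∉ D → G.Inc e v →
      t = if J e = 1 then x (ob v) + 1 else x (ob v) + 2 := by
    intro e
    by_cases he : e ∈ E(G)
    · obtain ⟨u, w, hl⟩ := exists_isLink_of_mem_edgeSet he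
      refine ⟨if J e = 1 then x (ob u) + 1 else x (ob u) + 2, fun v heD hv ↦ ?_⟩
      rw [hreachY (.inl heD) hl.inc_left hv]
    · exact ⟨0, fun v _ hv ↦ absurd hv.edge_mem he⟩
  choose τ hτ using hτ
  have hχ : ∀ e, ∃ i, ∀ v, e ∈ D → G.Inc e v → i = if cyc (G.part D v) then x (ob v) else
      σ (side (G.part D v)) (col (G.part D v) e) := by
    intro e
    by_cases he : e ∈ E(G)
    · obtain ⟨u, w, hl⟩ := exists_isLink_of_mem_edgeSet he
      refine ⟨if cyc (G.part D u) then x (ob u) else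
        σ (side (G.part D u)) (col (G.part D u) e), fun v heD hv ↦ ?_⟩
      have hr := hreach heD hl.inc_left hv
      by_cases hcu : cyc (G.part D u)
      · rw [if_pos hcu, if_pos ((hcy hr).1 hcu), hob.2 (hDY hr hcu)]
      · rw [if_neg hcu, if_neg ((hcy hr).not.1 hcu), part_eq_of_reach hr]
    · exact ⟨0, fun v _ hv ↦ absurd hv.edge_mem he⟩
  choose χ hχ using hχ
  have hχc : ∀ {e v}, e ∈ D → G.Inc e v → cyc (G.part D v) → χ e = x (ob v) :=
    fun he hv hcv ↦ (hχ _ _ he hv).trans (if_pos hcv)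
  have hχk : ∀ {e v}, e ∈ D → G.Inc e v → ¬ cyc (G.part D v) →
      χ e = σ (side (G.part D v)) (col (G.part D v) e) :=
    fun he hv hcv ↦ (hχ _ _ he hv).trans (if_neg hcv)
  have hτne : ∀ {e v}, e ∉ D → G.Inc e v → τ e ≠ x (ob v) := by
    intro e v he hv
    rw [hτ e v he hv]
    generalize x (ob v) = y
    have : ∀ y : Fin 3, y + 1 ≠ y ∧ y + 2 ≠ y := by decide
    split_ifs
    exacts [(this y).1, (this y).2]
  have hτSt : ∀ {d v}, v ∈ St → d ∉ D → G.Inc d v → τ d = f v := by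
    intro d v hv hd hdv
    obtain ⟨hvV, hvc, -⟩ := (memSt v).1 hv
    obtain ⟨a, b, h1, h2, h3, hI, ha, hb⟩ := htri.exists_of_isLight hdv hd
    have hav : G.Inc a v := by rw [← mem_incidenceSet, hI]; simp
    have hbv : G.Inc b v := by rw [← mem_incidenceSet, hI]; simp
    have hB := hJb v
    rw [boundary_eq_of_incidenceSet hE h1 h2 h3 hI, hJ0 a ((hYcyc ha hav).not.2 hvc),
      hJ0 b ((hYcyc hb hbv).not.2 hvc), zero_add, zero_add] at hB
    rw [hτ d v hd hdv, hB]
    have hfx := hf.ne_excluded v hv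
    simp only [T, Finset.mem_filter, hv, true_and]
    revert hfx
    generalize x (ob v) = y
    generalize f v = z
    revert y z; decide
  refine hasCycleDoubleCover_of_types hG hc D χ τ ?_ ?_
  · intro v hv
    by_cases hcv : cyc (G.part D v)
    · obtain ⟨d, hd, hdv⟩ := hcycLight v hv hcv
      obtain ⟨a, b, h1, h2, h3, hI, ha, hb⟩ := htri.exists_of_isLight hdv hd
      have hav : G.Inc a v := by rw [← mem_incidenceSet, hI]; simp
      have hbv : G.Inc b v := by rw [← mem_incidenceSet, hI]; simp
      refine ⟨a, b, d, h1, h2, h3, hI, ha, hb, .inr ⟨hd, ?_, ?_⟩⟩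
      · rw [hχc ha hav hcv, hχc hb hbv hcv]
      · rw [hχc ha hav hcv]; exact hτne hd hdv
    · obtain ⟨a, b, d, h1, h2, h3, hI, ha, hb, h⟩ := (hcol v hv hcv).exists_triple v
        (Reach.refl _ _)
      have hav : G.Inc a v := by rw [← mem_incidenceSet, hI]; simp
      have hbv : G.Inc b v := by rw [← mem_incidenceSet, hI]; simp
      have hdv : G.Inc d v := by rw [← mem_incidenceSet, hI]; simp
      rw [mem_edgeSet_part_iff hav] at ha
      rw [mem_edgeSet_part_iff hbv] at hb
      rw [mem_edgeSet_part_iff hdv] at h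
      refine ⟨a, b, d, h1, h2, h3, hI, ha, hb, ?_⟩
      rw [hχk ha hav hcv, hχk hb hbv hcv]
      rcases h with ⟨hd, h⟩ | ⟨hd, h⟩
      · rw [hχk hd hdv hcv]
        simpa only [ne_eq, EmbeddingLike.apply_eq_iff_eq] using .inl ⟨hd, h⟩
      · refine .inr ⟨hd, by rw [h], ?_⟩
        have hvS : v ∈ St := (memSt v).2 ⟨hv, hcv, d, hd, hdv⟩
        rw [hτSt hvS hd hdv, hsc v hvS a ha hav]
        exact hf.ne_color v hvS
  · intro t T' hT' u hu A hA
    obtain ⟨d, hd, hdu, hdt⟩ := (hT' u).1 hu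
    have huV := hdu.vertex_mem
    -- the walks avoiding the edges on which `t` is excluded join the vertices of type `t`
    have hχτ : ∀ {v d}, d ∉ D → G.Inc d v → τ d = t → ∃ a ∈ D, G.Inc a v ∧ χ a ≠ t := by
      intro v d hd hdv hdt
      obtain ⟨a, b, h1, h2, h3, hI, ha, hb⟩ := htri.exists_of_isLight hdv hd
      have hav : G.Inc a v := by rw [← mem_incidenceSet, hI]; simp
      refine ⟨a, ha, hav, ?_⟩
      by_cases hcv : cyc (G.part D v)
      · rw [hχc ha hav hcv, ← hdt]; exact (hτne hd hdv).symm
      · have hvS : v ∈ St := (memSt v).2 ⟨hdv.vertex_mem, hcv, d, hd, hdv⟩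
        rw [hχk ha hav hcv, hsc v hvS a ha hav, ← hdt, hτSt hvS hd hdv]
        exact (hf.ne_color v hvS).symm
    have hA' : ∀ v, v ∈ A ↔ v ∈ T' ∧ G.Reach D u v := by
      intro v
      rw [hA]
      refine and_congr_right fun hv ↦ ⟨fun h ↦ h.mono fun e he ↦ he.1, fun h ↦ ?_⟩
      obtain ⟨d', hd', hdv', hdt'⟩ := (hT' v).1 hv
      obtain ⟨a, ha, hau, hat⟩ := hχτ hd hdu hdt
      obtain ⟨b, hb, hbv, hbt⟩ := hχτ hd' hdv' hdt'
      have haE : a ∈ E(G.part D u) := (mem_edgeSet_part_iff hau).2 ha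
      have hbE : b ∈ E(G.part D u) := by
        rw [part_eq_of_reach h]; exact (mem_edgeSet_part_iff hbv).2 hb
      by_cases hcu : cyc (G.part D u)
      · have hxt : x (ob u) ≠ t := by rw [← hχc ha hau hcu]; exact hat
        refine ((hcyc u huV hcu (x (ob u))).reach t u v a b hau haE hxt hbv hbE hxt).mono ?_
        rintro e ⟨he, -⟩
        obtain ⟨heD, w, hew, hwu⟩ := mem_edgeSet_part.1 he
        refine ⟨heD, ?_⟩
        rw [hχc heD hew ((hcy hwu).1 hcu), ← hob.2 (hDY hwu hcu)]
        exact hxt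
      · have hi : ∀ {e w}, e ∈ D → G.Inc e w → G.Reach D u w →
            (χ e ≠ t ↔ col (G.part D u) e ≠ (σ (side (G.part D u))).symm t) := by
          intro e w he hew hw
          rw [hχk he hew ((hcy hw).not.1 hcu), ← part_eq_of_reach hw, Ne, Ne,
            Equiv.eq_symm_apply]
        refine ((hcol u huV hcu).reach ((σ (side (G.part D u))).symm t) u v a b hau haE
          ((hi ha hau (Reach.refl _ _)).1 hat) hbv hbE ((hi hb hbv h).1 hbt)).mono ?_
        rintro e ⟨he, hne⟩
        obtain ⟨heD, w, hew, hwu⟩ := mem_edgeSet_part.1 he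
        exact ⟨heD, (hi heD hew hwu).2 hne⟩
    by_cases hcu : cyc (G.part D u)
    · let B : Finset α := hG.1.toFinset.filter (G.Reach D u)
      have memB : ∀ v, v ∈ B ↔ G.Reach D u v := fun v ↦ by
        simp only [B, Finset.mem_filter, Set.Finite.mem_toFinset, and_iff_right_iff_imp]
        exact fun h ↦ h.mem huV
      have hm : ∀ v, ∃ d, v ∈ B → d ∉ D ∧ G.Inc d v := by
        intro v
        by_cases hv : v ∈ B
        · have hr := (memB v).1 hv
          obtain ⟨d, h⟩ := hcycLight v (hr.mem huV) ((hcy hr).1 hcu)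
          exact ⟨d, fun _ ↦ h⟩
        · exact ⟨d, fun h ↦ absurd h hv⟩
      choose m hm using hm
      have hobB : ∀ v ∈ B, ob v = ob u := fun v hv ↦ (hob.2 (hDY ((memB v).1 hv) hcu)).symm
      have hsum : ∑ v ∈ B, J (m v) = 0 := by
        have e1 := sum_boundary_eq_zero (G := G) hG.2.toFinset (fun e ↦ if e ∈ D then J e else 0) B
          (fun e v w he hl hv ↦ (memB w).2 (((memB v).1 hv).trans
            (hl.reach (by by_contra hn; simp [hn] at he))))
        have e2 : ∑ v ∈ B, G.boundary hG.2.toFinset J v = 0 := by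
          refine Finset.sum_eq_zero fun v hv ↦ ?_
          rw [hJb, if_neg]
          intro h
          exact ((memSt v).1 (Finset.mem_filter.1 h).1).2.1 ((hcy ((memB v).1 hv)).1 hcu)
        have e3 : ∑ v ∈ B, G.boundary hG.2.toFinset J v = ∑ v ∈ B, (J (m v) +
            G.boundary hG.2.toFinset (fun e ↦ if e ∈ D then J e else 0) v) := by
          refine Finset.sum_congr rfl fun v hv ↦ ?_
          obtain ⟨a, b, h1, h2, h3, hI, ha, hb⟩ := htri.exists_of_isLight (hm v hv).2 (hm v hv).1
          rw [boundary_eq_of_incidenceSet hE h1 h2 h3 hI, boundary_eq_of_incidenceSet hE h1 h2 h3 hI,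
            if_pos ha, if_pos hb, if_neg (hm v hv).1]
          ring
        rw [Finset.sum_add_distrib, e1, e2, add_zero] at e3
        exact e3.symm
      have hpar : valueParity B (fun v ↦ τ (m v)) t = 0 := by
        refine valueParity_eq_zero (x := x (ob u)) ?_ ?_ ?_ t
        · intro v hv
          rw [← hobB v hv]
          exact hτne (hm v hv).1 (hm v hv).2
        · exact (ZMod.natCast_eq_zero_iff_even).2 (hcard u huV B memB)
        · rw [← hsum]
          refine Finset.sum_congr rfl fun v hv ↦ ?_
          beta_reduce
          rw [hτ _ v (hm v hv).1 (hm v hv).2, hobB v hv]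
          generalize J (m v) = j
          generalize x (ob u) = y
          revert j y; decide
      rw [valueParity_eq_zero_iff] at hpar
      convert hpar using 2
      ext v
      rw [hA', hT', Finset.mem_filter]
      constructor
      · rintro ⟨⟨d', hd', hdv', hdt'⟩, hr⟩
        have hv := (memB v).2 hr
        refine ⟨hv, ?_⟩
        rw [← htri.unique hdv' (hm v hv).2 hd' (hm v hv).1, hdt']
      · rintro ⟨hv, hvt⟩
        exact ⟨⟨m v, (hm v hv).1, (hm v hv).2, hvt⟩, (memB v).1 hv⟩
    -- A side determines its noncyclic component, so evenness on the side is evenness on the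
    -- component of `u`.
    · have h0 := hfs (side (G.part D u)) t
      rw [valueParity_eq_zero_iff] at h0
      convert h0 using 2
      ext v
      rw [hA', hT', Finset.mem_filter, Finset.mem_filter, memSt]
      constructor
      · rintro ⟨⟨d', hd', hdv', hdt'⟩, hr⟩
        have hvc := (hcy hr).not.1 hcu
        have hvS := (memSt v).2 ⟨hdv'.vertex_mem, hvc, d', hd', hdv'⟩
        exact ⟨⟨(memSt v).1 hvS, by rw [part_eq_of_reach hr]⟩, by rw [← hτSt hvS hd' hdv', hdt']⟩
      · rintro ⟨⟨hvS', hvs⟩, hft⟩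
        have hvS := (memSt v).2 hvS'
        obtain ⟨hvV, hvc, d', hd', hdv'⟩ := hvS'
        refine ⟨⟨d', hd', hdv', by rw [hτSt hvS hd' hdv', hft]⟩, ?_⟩
        rw [← mem_part, hside u huV v hvV hcu hvc hvs.symm]
        exact Reach.refl _ _

end Graph

/-! ### The components of the frame and the conclusion. -/

namespace Graph

variable {α β : Type*} {G F : Graph α β}

/-- The components of a spanning subgraph, described inside the whole graph. -/
theorem IsSpanningSubgraph.isComponent_part (h : F ≤s G) {v : α} (hv : v ∈ V(G)) :
    (G.part E(F) v).IsComponent F := by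
  refine ⟨IsClosedSubgraph.mk' ⟨fun u hu ↦ ?_, fun e x y hl ↦ ?_⟩ fun e x he hx ↦ ?_,
    part_isConnected _ _⟩
  · rw [h.vertexSet_eq]; exact (mem_part.1 hu).mem hv
  · obtain ⟨h1, h2, -⟩ := part_isLink.1 hl
    exact (h.le.isLink_iff h1).2 h2
  · exact mem_edgeSet_part.2 ⟨he.edge_mem, x, he.mono h.le, hx⟩

/-- Comparison with one chosen element separates at most two elements. This is where the bound on
the number of K-components enters. -/
theorem exists_bool_injOn {S : Type*} {A : Set S} (h : A.encard ≤ 2) :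
    ∃ f : S → Bool, Set.InjOn f A := by
  classical
  obtain rfl | ⟨a, ha⟩ := A.eq_empty_or_nonempty
  · exact ⟨fun _ ↦ true, Set.injOn_empty _⟩
  refine ⟨fun s ↦ decide (s = a), fun x hx y hy hxy ↦ ?_⟩
  by_contra hne
  have hxa : x ≠ a := fun h ↦ hne (by simp [h] at hxy; rw [h, hxy])
  have hya : y ≠ a := fun h ↦ hne (by simp [h] at hxy; rw [h, hxy])
  have h3 : ({x, y, a} : Set S).encard = 3 := Set.encard_eq_three.2 ⟨x, y, a, hne, hxa, hya, rfl⟩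
  have hsub : ({x, y, a} : Set S) ⊆ A := by
    rintro z (rfl | rfl | rfl) <;> assumption
  have := (Set.encard_le_encard hsub).trans h
  rw [h3] at this
  exact absurd this (by decide)

end Graph

theorem corollary2 {α β : Type*} (G F : Graph α β)
    (hfin : G.IsFinite) (hloop : G.Loopless) (hcubic : G.IsCubic)
    (hF : F.IsKotzigFrame G) (hK : F.kComponents.encard ≤ 2) :
    Graph.HasCycleDoubleCover 6 G := by
  classical
  have hcomp : ∀ v ∈ G.vertexSet, (G.part F.edgeSet v).IsComponent F := fun v hv ↦
    hF.spanning.isComponent_part hv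
  obtain ⟨side, hside⟩ := Graph.exists_bool_injOn hK
  -- The coloring is chosen for the component rather than for a vertex, so all vertices of a
  -- component share it.
  have hcol : ∀ L : Graph α β, ∃ c : β → Fin 3, L ≤ G → L.IsKotzigSubdivision →
      Graph.IsFrameColoring G L c := by
    intro L
    by_cases h : L ≤ G ∧ L.IsKotzigSubdivision
    · obtain ⟨c, hc⟩ := Graph.IsFrameColoring.exists_of_isKotzigSubdivision hcubic h.1 h.2
      exact ⟨c, fun _ _ ↦ hc⟩
    · exact ⟨fun _ ↦ 0, fun h1 h2 ↦ absurd ⟨h1, h2⟩ h⟩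
  choose col hcol using hcol
  refine Graph.hasCycleDoubleCover_of_frameColorings hfin hcubic F.edgeSet Graph.IsCycle side col
    (fun v hv ↦ hF.even _ (hcomp v hv)) (fun v hv hc ↦ ?_)
    (fun v hv hc j ↦ Graph.IsFrameColoring.of_isCycle hcubic (Graph.part_le hv) hc j)
    (fun u hu v hv hcu hcv h ↦ hside ⟨hcomp u hu, hcu⟩ ⟨hcomp v hv, hcv⟩ h)
  exact hcol _ (Graph.part_le hv) ((hF.cycle_or_kotzig _ (hcomp v hv)).resolve_left hc)
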